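/- **Setting.** Let $G$ be an undirected graph on a finite set $V$ of $N$ agents, $n(i)$ the set of neighbours of $i$, and let $B_{ij},D\in\mathbb R^{m\times m}$. The state of the world is $\theta\in\mathbb R^m$, with the uniform (improper) prior on $\mathbb R^m$. Agent $i$ observes $x_i=\theta+\epsilon_i$, where the $\epsilon_i\sim\mathcal N(0,C_i)$ are independent across agents and of $\theta$, and each covariance matrix $C_i$ is diagonal. Put $x=[x_1[1],\dots,x_N[1],\dots,x_1[m],\dots,x_N[m]]^T\in\mathbb R^{Nm}$. At each time $t=0,1,2,\dots$ agent $i$ plays $a_i(t)=\sigma_{i,t}(h_{i,t})\in\mathbb R^m$, where $h_{i,t}=\{x_i,\ a_j(u): j\in n(i),\,u<t\}$ and $\sigma_{i,t}$ is measurable. Its stage payoff is $$u_i(a,\theta)=-\tfrac12\sum_{j\in V}a_j^Ta_j+\sum_{j\ne i}a_i^TB_{ij}a_j+a_i^TD\theta .$$ Write $\mathbb P_{i,t}$, $\mathbb E_{i,t}$ for the conditional distribution of $(\theta,x)$ given $h_{i,t}$ and its expectation. The profile is an equilibrium at stage $t$ if for every $i$ and almost every history, $\sigma_{i,t}(h_{i,t})$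 maximizes $a_i\mapsto\mathbb E_{i,t}[u_i(a_i,\{\sigma_{j,t}(h_{j,t})\}_{j\neq i},\theta)]$ over $\mathbb R^m$. **Recursion.** For $U_{i,t}\in\mathbb R^{m\times Nm}$ define matrices $L_{i,t}$, $Q_{i,t}$, $M^i_{xx}(t)$, $M^i_{\theta\theta}(t)$, $M^i_{\theta x}(t)$ as follows. Let $e_i\in\mathbb R^N$ be the $i$-th standard basis vector, $\bar e_i=\mathbf 1-e_i$, and let $I_m\otimes A$ be the block diagonal matrix with $m$ copies of $A$. The initial values are $$L_{i,0}=I_m\otimes(\mathbf 1e_i^T),\quad Q_{i,0}=I_m\otimes e_i^T,\quad M^i_{\theta\theta}(0)=C_i,\quad M^i_{\theta x}(0)=C_i\,(I_m\otimes\bar e_i^T),$$ and $M^i_{xx}(0)$ is block diagonal with $N\times N$ blocks $\mathrm{diag}(\bar e_i)\,\mathrm{diag}(C_1[k,k],\dots,C_N[k,k])+\bar e_i\bar e_i^T\,C_i[k,k]$, $k=1,\dots,m$. Let $H_{i,t}^T$ be the matrix with the block rows $U_{j,t}L_{j,t}$, $j\in n(i)$, and $$K^i_x(t)=M^i_{xx}(t)H_{i,t}\big(H_{i,t}^TM^i_{xx}(t)H_{i,t}\big)^{+},\qquad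 K^i_\theta(t)=M^i_{\theta x}(t)H_{i,t}\big(H_{i,t}^TM^i_{xx}(t)H_{i,t}\big)^{+},$$ where $^+$ is the Moore-Penrose inverse (the inverse, when it exists). Then $$L_{i,t+1}=L_{i,t}+K^i_x(t)(H_{i,t}^T-H_{i,t}^TL_{i,t}),\qquad Q_{i,t+1}=Q_{i,t}+K^i_\theta(t)(H_{i,t}^T-H_{i,t}^TL_{i,t}),$$ $$M^i_{xx}(t+1)=M^i_{xx}(t)-K^i_x(t)H_{i,t}^TM^i_{xx}(t),\qquad M^i_{\theta x}(t+1)=M^i_{\theta x}(t)-K^i_\theta(t)H_{i,t}^TM^i_{xx}(t),$$ $$M^i_{\theta\theta}(t+1)=M^i_{\theta\theta}(t)-K^i_\theta(t)H_{i,t}^TM^i_{\theta x}(t)^T .$$ **Theorem.** Suppose that the agents play linear strategies $\sigma_{i,t}(h_{i,t})=U_{i,t}\,\mathbb E_{i,t}[x]$ for all $i\in V$, $t\in\mathbb N$ (at almost every history). Then: 1. for all $i$ and $t$ the belief $\mathbb P_{i,t}$ is almost surely Gaussian, with means $\mathbb E_{i,t}[\theta]=Q_{i,t}x$ and $\mathbb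 E_{i,t}[x]=L_{i,t}x$ and with error covariance matrices $M^i_{xx}(t)$, $M^i_{\theta\theta}(t)$, $M^i_{\theta x}(t)$; 2. for every $t$, the profile is an equilibrium at stage $t$ if and only if $$L_{i,t}^TU_{i,t}^T=\sum_{j\ne i}L_{i,t}^TL_{j,t}^TU_{j,t}^TB_{ij}^T+Q_{i,t}^TD^T\qquad\text{for all } i\in V .$$ In particular, the action coefficients $U_{i,t}$ of a linear equilibrium strategy solve these linear equations. -/

import Mathlib

open MeasureTheory ProbabilityTheory Matrix

noncomputable section

namespace QuadraticNetworkGame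

section PseudoInverse

/-- The four Penrose equations: `G` is the Moore-Penrose inverse of the real matrix `A`. -/
structure IsMoorePenrose {r s : Type*} [Fintype r] [Fintype s]
    (A : Matrix r s ℝ) (G : Matrix s r ℝ) : Prop where
  mul_mul_self : A * G * A = A
  self_mul_mul : G * A * G = G
  symm_left : (A * G)ᵀ = A * G
  symm_right : (G * A)ᵀ = G * A

theorem exists_isMoorePenrose_of_symm {r : Type*} [Fintype r]
    (S : Matrix r r ℝ) (hS : Sᵀ = S) : ∃ G, IsMoorePenrose S G ∧ Gᵀ = G := by
  classical
  have hH : S.IsHermitian := by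
    unfold Matrix.IsHermitian
    rw [conjTranspose_eq_transpose_of_trivial, hS]
  set W : Matrix r r ℝ := (hH.eigenvectorUnitary : Matrix r r ℝ) with hW
  set d : r → ℝ := hH.eigenvalues with hd
  have hWW : Wᵀ * W = 1 := by
    have h := (Unitary.mem_iff.1 hH.eigenvectorUnitary.2).1
    rwa [star_eq_conjTranspose, conjTranspose_eq_transpose_of_trivial] at h
  have hsp : S = W * diagonal d * Wᵀ := by
    have h := hH.spectral_theorem
    rw [Unitary.conjStarAlgAut_apply, star_eq_conjTranspose,
      conjTranspose_eq_transpose_of_trivial] at h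
    exact h
  have key : ∀ a b : r → ℝ, (W * diagonal a * Wᵀ) * (W * diagonal b * Wᵀ)
      = W * diagonal (fun i => a i * b i) * Wᵀ := by
    intro a b
    calc (W * diagonal a * Wᵀ) * (W * diagonal b * Wᵀ)
        = W * diagonal a * (Wᵀ * W) * diagonal b * Wᵀ := by simp only [Matrix.mul_assoc]
      _ = _ := by
        rw [hWW, Matrix.mul_one, Matrix.mul_assoc W, diagonal_mul_diagonal]
  have hsym : ∀ a : r → ℝ, (W * diagonal a * Wᵀ)ᵀ = W * diagonal a * Wᵀ := by
    intro a
    simp [Matrix.transpose_mul, Matrix.mul_assoc]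
  refine ⟨W * diagonal (fun i => (d i)⁻¹) * Wᵀ, ⟨?_, ?_, ?_, ?_⟩, hsym _⟩
  · rw [hsp, key, key]
    congr 3
    funext i
    exact mul_inv_mul_cancel (d i)
  · rw [hsp, key, key]
    congr 3
    funext i
    by_cases h : d i = 0 <;> simp [h]
  · rw [hsp, key, hsym]
  · rw [hsp, key, hsym]

theorem exists_isMoorePenrose {r s : Type*} [Fintype r] [Fintype s]
    (A : Matrix r s ℝ) : ∃ G, IsMoorePenrose A G := by
  obtain ⟨P, hP, hPs⟩ := exists_isMoorePenrose_of_symm (Aᵀ * A) (by simp)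
  have h1 : A * P * Aᵀ * A = A := by
    classical
    have h0 : (A * (P * (Aᵀ * A) - 1))ᴴ * (A * (P * (Aᵀ * A) - 1)) = 0 := by
      have h2 : Aᵀ * (A * (P * (Aᵀ * A) - 1)) = 0 := by
        have := hP.mul_mul_self
        rw [← Matrix.mul_assoc, Matrix.mul_sub, Matrix.mul_one, ← Matrix.mul_assoc, this,
          sub_self]
      rw [conjTranspose_eq_transpose_of_trivial, Matrix.transpose_mul, Matrix.mul_assoc, h2,
        Matrix.mul_zero]
    have h3 := conjTranspose_mul_self_eq_zero.1 h0
    rw [Matrix.mul_sub, Matrix.mul_one, sub_eq_zero] at h3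
    simpa only [Matrix.mul_assoc] using h3
  refine ⟨P * Aᵀ, ⟨?_, ?_, ?_, ?_⟩⟩
  · simpa only [Matrix.mul_assoc] using h1
  · have := congrArg (· * Aᵀ) hP.self_mul_mul
    simpa only [Matrix.mul_assoc] using this
  · simp [Matrix.transpose_mul, hPs, Matrix.mul_assoc]
  · have := hP.symm_right
    simpa only [Matrix.mul_assoc] using this

/-- The Moore-Penrose inverse of a real matrix. -/
def pinv {r s : Type*} [Fintype r] [Fintype s] (A : Matrix r s ℝ) : Matrix s r ℝ :=
  (exists_isMoorePenrose A).choose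

theorem pinv_spec {r s : Type*} [Fintype r] [Fintype s] (A : Matrix r s ℝ) :
    IsMoorePenrose A (pinv A) :=
  (exists_isMoorePenrose A).choose_spec

/-- For an invertible matrix the Moore-Penrose inverse is the ordinary inverse. -/
theorem pinv_eq_inv {r : Type*} [Fintype r] [DecidableEq r] (A : Matrix r r ℝ)
    (hA : IsUnit A.det) : pinv A = A⁻¹ := by
  have h := (pinv_spec A).mul_mul_self
  calc pinv A = A⁻¹ * (A * pinv A * A) * A⁻¹ := by
        rw [Matrix.mul_assoc A, Matrix.nonsing_inv_mul_cancel_left _ _ hA,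
          Matrix.mul_nonsing_inv_cancel_right _ _ hA]
    _ = A⁻¹ := by rw [h, Matrix.nonsing_inv_mul _ hA, Matrix.one_mul]

end PseudoInverse

section Game

/-- A state of the world `θ ∈ ℝᵐ` together with the vector `x` of all private signals.
The coordinate `x (n, i)` is the `n`-th private signal of agent `i`; the index set `Fin m × V`
stacks the signals as `m` blocks, each of them indexed by the agents. -/
abbrev State (V : Type*) (m : ℕ) := (Fin m → ℝ) × (Fin m × V → ℝ)

/-- The law of the observation noise: the vectors `ε i` are independent across agents, and
`ε i` is a centred Gaussian vector with covariance matrix `C i`. -/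
def noise {V : Type*} [Fintype V] {m : ℕ} (C : V → Matrix (Fin m) (Fin m) ℝ) :
    Measure (V → EuclideanSpace ℝ (Fin m)) :=
  Measure.pi fun i => multivariateGaussian 0 (C i)

/-- The common prior on `(θ, x)`: nothing is known about `θ` before the signals are observed
(the uniform, improper prior on `ℝᵐ`), and the private signal of agent `i` is `θ + ε i`. -/
def prior {V : Type*} [Fintype V] {m : ℕ} (C : V → Matrix (Fin m) (Fin m) ℝ) :
    Measure (State V m) :=
  ((volume : Measure (Fin m → ℝ)).prod (noise C)).map
    fun ω => (ω.1, fun p => ω.1 p.1 + ω.2 p.2 p.1)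

variable {V : Type*} {m : ℕ}

/-- Histories of agent `i` at time `t`: the own private signal, and the actions of all
neighbours at the times `u < t`. -/
abbrev History (G : SimpleGraph V) (m : ℕ) (i : V) (t : ℕ) :=
  (Fin m → ℝ) × (Fin t → G.neighborSet i → Fin m → ℝ)

/-- A (pure) strategy profile: maps from histories to actions. -/
abbrev Strategy (G : SimpleGraph V) (m : ℕ) :=
  ∀ (i : V) (t : ℕ), History G m i t → (Fin m → ℝ)

/-- The action of agent `i` at time `t` when the profile `σ` is played and the private signals
are `x`. -/
def action (G : SimpleGraph V) (σ : Strategy G m) (x : Fin m × V → ℝ) (t : ℕ) (i : V) :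
    Fin m → ℝ :=
  σ i t (fun n => x (n, i), fun u j => action G σ x u.1 j.1)
termination_by t
decreasing_by exact u.2

/-- The history that agent `i` has observed at time `t` when the profile `σ` is played and the
private signals are `x`. -/
def history (G : SimpleGraph V) (σ : Strategy G m) (i : V) (t : ℕ) (x : Fin m × V → ℝ) :
    History G m i t :=
  (fun n => x (n, i), fun u j => action G σ x u.1 j.1)

/-- `P i t` is the conditional distribution of `(θ, x)` given the history of agent `i` at
time `t` (a regular conditional distribution, by disintegration of the prior with respect to the
history), when the profile `σ` is played. -/
structure IsBeliefSystem [Fintype V] (G : SimpleGraph V)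
    (C : V → Matrix (Fin m) (Fin m) ℝ) (σ : Strategy G m)
    (P : ∀ (i : V) (t : ℕ), Kernel (History G m i t) (State V m)) : Prop where
  markov : ∀ i t, IsMarkovKernel (P i t)
  disintegration : ∀ i t,
    (prior C).map (fun ω => (history G σ i t ω.2, ω))
      = ((prior C).map fun ω => history G σ i t ω.2) ⊗ₘ P i t

/-- Expectation of the vector of private signals under the belief `ν`. -/
def expSignals (ν : Measure (State V m)) : Fin m × V → ℝ := fun p => ∫ ω, ω.2 p ∂ν

/-- Expectation of the state of the world under the belief `ν`. -/
def expState (ν : Measure (State V m)) : Fin m → ℝ := fun k => ∫ ω, ω.1 k ∂ν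

/-- The quadratic payoff of agent `i` for the action profile `a` in the state `θ`. -/
def payoff [Fintype V] [DecidableEq V] (B : V → V → Matrix (Fin m) (Fin m) ℝ)
    (D : Matrix (Fin m) (Fin m) ℝ) (i : V) (a : V → Fin m → ℝ) (θ : Fin m → ℝ) : ℝ :=
  -(1 / 2) * ∑ j, a j ⬝ᵥ a j + ∑ j ∈ Finset.univ.erase i, a i ⬝ᵥ (B i j *ᵥ a j)
    + a i ⬝ᵥ (D *ᵥ θ)

/-- The Bayes-Nash fixed point condition at stage `t`: for (almost) every history, the
prescribed action of each agent maximizes the conditional expectation of the payoff, given the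
history and the strategies of the other agents. -/
def IsStageEquilibrium [Fintype V] [DecidableEq V] (G : SimpleGraph V)
    (B : V → V → Matrix (Fin m) (Fin m) ℝ) (D : Matrix (Fin m) (Fin m) ℝ)
    (C : V → Matrix (Fin m) (Fin m) ℝ) (σ : Strategy G m)
    (P : ∀ (i : V) (t : ℕ), Kernel (History G m i t) (State V m)) (t : ℕ) : Prop :=
  ∀ i, ∀ᵐ ω ∂prior C,
    (∀ a : Fin m → ℝ, Integrable
      (fun ω' => payoff B D i (Function.update (action G σ ω'.2 t) i a) ω'.1)
      (P i t (history G σ i t ω.2))) ∧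
    IsMaxOn (fun a : Fin m → ℝ =>
      ∫ ω', payoff B D i (Function.update (action G σ ω'.2 t) i a) ω'.1
        ∂(P i t (history G σ i t ω.2)))
      Set.univ (σ i t (history G σ i t ω.2))

/-- The profile `σ` is linear with action coefficients `U`: at (almost) every history the action
of agent `i` at time `t` is `U i t` times its conditional expectation of the private signals. -/
def IsLinearProfile [Fintype V] (G : SimpleGraph V)
    (C : V → Matrix (Fin m) (Fin m) ℝ) (σ : Strategy G m)
    (P : ∀ (i : V) (t : ℕ), Kernel (History G m i t) (State V m))
    (U : V → ℕ → Matrix (Fin m) (Fin m × V) ℝ) : Prop :=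
  ∀ i t, ∀ᵐ ω ∂prior C,
    σ i t (history G σ i t ω.2) = U i t *ᵥ expSignals (P i t (history G σ i t ω.2))

end Game

section Recursion

/-- The estimation weights and the error covariance matrices of one agent at one time. -/
structure Estimate (V : Type*) (m : ℕ) where
  /-- weights of the estimate `L x` of the private signals -/
  L : Matrix (Fin m × V) (Fin m × V) ℝ
  /-- weights of the estimate `Q x` of the state of the world -/
  Q : Matrix (Fin m) (Fin m × V) ℝ
  /-- error covariance of the private signals -/
  Mxx : Matrix (Fin m × V) (Fin m × V) ℝ
  /-- error covariance of the state of the world -/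
  Mθθ : Matrix (Fin m) (Fin m) ℝ
  /-- error cross covariance of the state of the world and the private signals -/
  Mθx : Matrix (Fin m) (Fin m × V) ℝ

variable {V : Type*} [Fintype V] [DecidableEq V] {m : ℕ}

/-- The standard basis vector `e i` of `ℝ^V`. -/
def basisVec (i : V) : V → ℝ := fun j => if j = i then 1 else 0

/-- The all-one vector with its `i`-th component nulled. -/
def coBasisVec (i : V) : V → ℝ := fun j => 1 - basisVec i j

/-- The initial values of agent `i`. -/
def Estimate.init (C : V → Matrix (Fin m) (Fin m) ℝ) (i : V) : Estimate V m where
  L := Matrix.of fun p q =>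
    if p.1 = q.1 then vecMulVec (1 : V → ℝ) (basisVec i) p.2 q.2 else 0
  Q := Matrix.of fun k q => if k = q.1 then basisVec i q.2 else 0
  Mxx := Matrix.of fun p q =>
    if p.1 = q.1 then
      (diagonal (coBasisVec i) * diagonal (fun j => C j p.1 p.1)
        + C i p.1 p.1 • vecMulVec (coBasisVec i) (coBasisVec i)) p.2 q.2
    else 0
  Mθθ := C i
  Mθx := C i * Matrix.of fun k q => if k = q.1 then coBasisVec i q.2 else 0

/-- The transposed observation matrix of agent `i`: its block of rows for the neighbour `j` is
`U j * L j`, so that it maps the private signals to the actions of the neighbours of `i`. -/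
def obsMatrix (G : SimpleGraph V) (U : V → Matrix (Fin m) (Fin m × V) ℝ)
    (L : V → Matrix (Fin m × V) (Fin m × V) ℝ) (i : V) :
    Matrix (G.neighborSet i × Fin m) (Fin m × V) ℝ :=
  Matrix.of fun r q => (U r.1 * L r.1) r.2 q

/-- One step of the sequential LMMSE recursion, for the observation `Ht *ᵥ x`. The gains
are `Mxx * Htᵀ * (Ht * Mxx * Htᵀ)⁻¹` and `Mθx * Htᵀ * (Ht * Mxx * Htᵀ)⁻¹`, with the
Moore-Penrose inverse where the matrix in parentheses is singular. -/
def Estimate.step {R : Type*} [Fintype R] (E : Estimate V m)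
    (Ht : Matrix R (Fin m × V) ℝ) : Estimate V m :=
  let Kx : Matrix (Fin m × V) R ℝ := E.Mxx * Htᵀ * pinv (Ht * E.Mxx * Htᵀ)
  let Kθ : Matrix (Fin m) R ℝ := E.Mθx * Htᵀ * pinv (Ht * E.Mxx * Htᵀ)
  { L := E.L + Kx * (Ht - Ht * E.L)
    Q := E.Q + Kθ * (Ht - Ht * E.L)
    Mxx := E.Mxx - Kx * Ht * E.Mxx
    Mθθ := E.Mθθ - Kθ * Ht * E.Mθxᵀ
    Mθx := E.Mθx - Kθ * Ht * E.Mxx }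

/-- The estimation weights and error covariances of all agents at all times, for the action
coefficients `U`. -/
def estimates (G : SimpleGraph V) [DecidableRel G.Adj] (C : V → Matrix (Fin m) (Fin m) ℝ)
    (U : V → ℕ → Matrix (Fin m) (Fin m × V) ℝ) : ℕ → V → Estimate V m
  | 0 => Estimate.init C
  | t + 1 => fun i => (estimates G C U t i).step
      (obsMatrix G (fun j => U j t) (fun j => (estimates G C U t j).L) i)

/-- The belief `ν` on `(θ, x)` is Gaussian, with the linear means `Q x` and `L x` and with the
error covariance matrices that are recorded in `E`. -/
structure IsGaussianBelief (ν : Measure (State V m)) (E : Estimate V m)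
    (x : Fin m × V → ℝ) : Prop where
  gaussian : IsGaussian ν
  mean_state : expState ν = E.Q *ᵥ x
  mean_signals : expSignals ν = E.L *ᵥ x
  cov_xx : ∀ p q, cov[fun ω => ω.2 p, fun ω => ω.2 q; ν] = E.Mxx p q
  cov_θθ : ∀ k l, cov[fun ω => ω.1 k, fun ω => ω.1 l; ν] = E.Mθθ k l
  cov_θx : ∀ k q, cov[fun ω => ω.1 k, fun ω => ω.2 q; ν] = E.Mθx k q

end Recursion

end QuadraticNetworkGame

end

/-!
The idea is to coordinatize `(θ, x)` by the private signal `y` of one agent `i` and by the noise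
`ε`. Since the prior of `θ` is uniform, `y` is uniformly distributed and independent of `ε`
(`prior_eq_map_own`), and all information that agent `i` collects later is a linear function of `y`
and of the signals relative to `y`, which are a function of `ε` alone (`relSignal`).

With `Γ` the covariance matrix of the noise, the estimation errors are `x - L x = (1 - L) ε` and
`θ - Q x = -Q ε`. The recursion preserves the resulting formulas for the covariance matrices and the
orthogonality principle: the errors are uncorrelated with all past observations
(`Estimate.IsLMMSE.step`, `estimates_uncorrelated_past`). A singular innovation covariance does no
harm, as the innovation vanishes in the directions that the Moore-Penrose inverse leaves out
(`gain_mul_cov`). For Gaussian noise uncorrelated means independent, so the joint law of history and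
`(θ, x)` disintegrates into translates of the law of the error
(`map_prod_eq_compProd_translateKernel`). Disintegrations over a `σ`-finite marginal are unique,
which identifies the belief (`ae_belief_eq`). This needs the history to be linear in `x`, which
follows from the statement about the beliefs at earlier times; hence the strong induction in
`ae_isGaussianBelief`.

Given Gaussian beliefs, the expected payoff is a strictly concave quadratic in the own action, and
the equilibrium condition is the first order condition, an identity between linear functions of `x`
that has to hold almost surely (`isStageEquilibrium_iff_ae`). If the noise is degenerate, `x` may
live on a proper subspace. The identity nevertheless extends to all `x`, because both sides factor
through `(Q x, L x)`, whose values are all attained on the support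
(`Estimate.AttainedOnSupport.step`).
-/

noncomputable section

namespace QuadraticNetworkGame

/-! ### Signals, noise and uncorrelated errors -/

section EstimateAlgebra

variable {V : Type*} {m : ℕ}

/-- The matrix that stacks a copy of the state of the world for each agent: the private signals
are `x = repState *ᵥ θ + ε`. -/
def repState (V : Type*) (m : ℕ) : Matrix (Fin m × V) (Fin m) ℝ :=
  Matrix.of fun p k => if p.1 = k then 1 else 0

theorem repState_mulVec (y : Fin m → ℝ) : repState V m *ᵥ y = fun p => y p.1 := by
  funext p
  simp [repState, mulVec, dotProduct]

variable [DecidableEq V]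

/-- The matrix that extracts the private signal of agent `i` from the vector of all signals. -/
def ownSignal (m : ℕ) (i : V) : Matrix (Fin m) (Fin m × V) ℝ :=
  Matrix.of fun k q => if k = q.1 then basisVec i q.2 else 0

/-- The covariance matrix of the stacked observation noise, for diagonal matrices `C i`. -/
def noiseCov (C : V → Matrix (Fin m) (Fin m) ℝ) : Matrix (Fin m × V) (Fin m × V) ℝ :=
  diagonal fun p => C p.2 p.1 p.1

/-- The matrix that subtracts the private signal of agent `i` from all signals. It annihilates
`repState`, so it maps the signals to a function of the noise alone. -/
def relSignal (m : ℕ) (i : V) : Matrix (Fin m × V) (Fin m × V) ℝ :=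
  1 - repState V m * ownSignal m i

theorem transpose_noiseCov (C : V → Matrix (Fin m) (Fin m) ℝ) :
    (noiseCov C)ᵀ = noiseCov C :=
  diagonal_transpose _

theorem relSignal_apply (i : V) (p q : Fin m × V) :
    relSignal m i p q
      = if p.1 = q.1 then (if p.2 = q.2 then 1 else 0) - basisVec i q.2 else 0 := by
  obtain ⟨k, a⟩ := p
  obtain ⟨l, b⟩ := q
  by_cases h : k = l <;>
    simp [relSignal, Matrix.one_apply, repState, ownSignal, Matrix.mul_apply, h]

variable [Fintype V]

theorem ownSignal_mulVec (i : V) (x : Fin m × V → ℝ) :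
    ownSignal m i *ᵥ x = fun k => x (k, i) := by
  funext k
  simp [ownSignal, mulVec, dotProduct, Fintype.sum_prod_type, basisVec]

theorem ownSignal_mul_repState (i : V) : ownSignal m i * repState V m = 1 := by
  refine Matrix.ext_of_mulVec_single fun k => ?_
  rw [← mulVec_mulVec, repState_mulVec, ownSignal_mulVec, one_mulVec]

/-- A linear function of the noise with vanishing covariance matrix is uncorrelated with every
linear function of the noise. -/
theorem mul_noiseCov_eq_zero {C : V → Matrix (Fin m) (Fin m) ℝ} (hC : ∀ i, (C i).PosSemidef)
    {R : Type*} [Fintype R] (W : Matrix R (Fin m × V) ℝ) (h : W * noiseCov C * Wᵀ = 0) :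
    W * noiseCov C = 0 := by
  have hR : noiseCov C = diagonal (fun p => √(C p.2 p.1 p.1))
      * (diagonal fun p => √(C p.2 p.1 p.1))ᵀ := by
    rw [diagonal_transpose, diagonal_mul_diagonal, noiseCov]
    congr 1
    funext p
    exact (Real.mul_self_sqrt ((hC p.2).diag_nonneg)).symm
  have h0 : (W * diagonal fun p : Fin m × V => √(C p.2 p.1 p.1)) = 0 := by
    have h1 := h
    rw [hR] at h1
    rw [← self_mul_conjTranspose_eq_zero, conjTranspose_eq_transpose_of_trivial,
      Matrix.transpose_mul, ← h1]
    simp only [Matrix.mul_assoc]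
  rw [hR, ← Matrix.mul_assoc, h0, Matrix.zero_mul]

/-- The estimation errors of `E`, which are `(1 - E.L) *ᵥ ε` for the signals and `-E.Q *ᵥ ε` for
the state, are uncorrelated with the values of `N` at the signals relative to that of agent
`i`. -/
def ErrorUncorrelated (C : V → Matrix (Fin m) (Fin m) ℝ) (i : V) (E : Estimate V m) {R : Type*}
    (N : Matrix R (Fin m × V) ℝ) : Prop :=
  (1 - E.L) * noiseCov C * (N * relSignal m i)ᵀ = 0 ∧
    E.Q * noiseCov C * (N * relSignal m i)ᵀ = 0

theorem ErrorUncorrelated.add {C : V → Matrix (Fin m) (Fin m) ℝ} {i : V} {E : Estimate V m}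
    {R : Type*} {N N' : Matrix R (Fin m × V) ℝ} (h : ErrorUncorrelated C i E N)
    (h' : ErrorUncorrelated C i E N') : ErrorUncorrelated C i E (N + N') := by
  constructor
  · rw [Matrix.add_mul, Matrix.transpose_add, Matrix.mul_add, h.1, h'.1, add_zero]
  · rw [Matrix.add_mul, Matrix.transpose_add, Matrix.mul_add, h.2, h'.2, add_zero]

theorem ErrorUncorrelated.mul_left {C : V → Matrix (Fin m) (Fin m) ℝ} {i : V} {E : Estimate V m}
    {R S : Type*} [Fintype R] {N : Matrix R (Fin m × V) ℝ} (h : ErrorUncorrelated C i E N)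
    (A : Matrix S R ℝ) : ErrorUncorrelated C i E (A * N) := by
  constructor
  · rw [Matrix.mul_assoc A, Matrix.transpose_mul A, ← Matrix.mul_assoc, h.1, Matrix.zero_mul]
  · rw [Matrix.mul_assoc A, Matrix.transpose_mul A, ← Matrix.mul_assoc, h.2, Matrix.zero_mul]

/-- `E` records unbiased linear estimates, with their error covariances, whose errors are
uncorrelated with the estimates themselves. -/
structure Estimate.IsLMMSE (C : V → Matrix (Fin m) (Fin m) ℝ) (i : V) (E : Estimate V m) :
    Prop where
  L_mul_repState : E.L * repState V m = repState V m
  Q_mul_repState : E.Q * repState V m = 1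
  Mxx_eq : E.Mxx = (1 - E.L) * noiseCov C * (1 - E.L)ᵀ
  Mθx_eq : E.Mθx = -(E.Q * noiseCov C * (1 - E.L)ᵀ)
  Mθθ_eq : E.Mθθ = E.Q * noiseCov C * E.Qᵀ
  uncorrelated_L : ErrorUncorrelated C i E E.L
  uncorrelated_Q : ErrorUncorrelated C i E E.Q

theorem Estimate.init_L (C : V → Matrix (Fin m) (Fin m) ℝ) (i : V) :
    (Estimate.init C i).L = repState V m * ownSignal m i := by
  ext p q
  simp [Estimate.init, repState, ownSignal, Matrix.mul_apply, vecMulVec_apply]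

theorem Estimate.init_Q (C : V → Matrix (Fin m) (Fin m) ℝ) (i : V) :
    (Estimate.init C i).Q = ownSignal m i := rfl

theorem ownSignal_mul_relSignal (i : V) : ownSignal m i * relSignal m i = 0 := by
  rw [relSignal, Matrix.mul_sub, ← Matrix.mul_assoc, ownSignal_mul_repState]
  simp

theorem Estimate.isLMMSE_init {C : V → Matrix (Fin m) (Fin m) ℝ} (hCdiag : ∀ i, (C i).IsDiag)
    (i : V) : (Estimate.init C i).IsLMMSE C i := by
  have hR : 1 - (Estimate.init C i).L = relSignal m i := by rw [Estimate.init_L]; rfl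
  have h0 : (Estimate.init C i).L * relSignal m i = 0 := by
    rw [Estimate.init_L, Matrix.mul_assoc, ownSignal_mul_relSignal, Matrix.mul_zero]
  have h1 : (Estimate.init C i).Q * relSignal m i = 0 := ownSignal_mul_relSignal i
  refine ⟨?_, ownSignal_mul_repState i, ?_, ?_, ?_, ⟨?_, ?_⟩, ⟨?_, ?_⟩⟩
  · rw [Estimate.init_L, Matrix.mul_assoc, ownSignal_mul_repState, Matrix.mul_one]
  · rw [hR]
    ext ⟨k, a⟩ ⟨l, b⟩
    rw [Matrix.mul_apply, Fintype.sum_prod_type]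
    by_cases hkl : k = l
    · subst hkl
      simp only [noiseCov, mul_diagonal, relSignal_apply, Matrix.transpose_apply, ite_mul, zero_mul,
        mul_ite, mul_zero, Finset.sum_ite_irrel, Finset.sum_const_zero, Finset.sum_ite_eq,
        Finset.mem_univ, if_true, Estimate.init, Matrix.of_apply, Matrix.add_apply,
        diagonal_mul_diagonal, Matrix.smul_apply, vecMulVec_apply, smul_eq_mul, diagonal_apply,
        coBasisVec, basisVec, sub_mul, mul_sub, Finset.sum_sub_distrib, mul_one, one_mul]
      by_cases ha : a = i <;> by_cases hb : b = i <;> by_cases hab : a = b <;> simp_all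
    · simp [noiseCov, mul_diagonal, relSignal_apply, Estimate.init, hkl]
  · rw [hR, Estimate.init_Q]
    ext k ⟨l, b⟩
    have hM : (Estimate.init C i).Mθx k (l, b) = C i k l * coBasisVec i b :=
      Matrix.mul_apply.trans (by simp)
    rw [hM, Matrix.neg_apply, Matrix.mul_apply, Fintype.sum_prod_type]
    by_cases hkl : k = l
    · subst hkl
      by_cases hb : b = i <;>
        simp [noiseCov, mul_diagonal, relSignal_apply, ownSignal, coBasisVec, basisVec, mul_sub, hb]
    · simp [noiseCov, mul_diagonal, relSignal_apply, ownSignal, hkl, hCdiag i hkl]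
  · rw [Estimate.init_Q]
    ext k l
    rw [Matrix.mul_apply, Fintype.sum_prod_type]
    by_cases hkl : k = l
    · subst hkl
      simp [noiseCov, mul_diagonal, ownSignal, Estimate.init, basisVec]
    · simp [noiseCov, mul_diagonal, ownSignal, Estimate.init, hkl, hCdiag i hkl]
  all_goals simp [h0, h1]

theorem sub_mul_relSignal {i : V} {E : Estimate V m}
    (h : E.L * repState V m = repState V m) : (1 - E.L) * relSignal m i = 1 - E.L := by
  rw [relSignal, Matrix.mul_sub, ← Matrix.mul_assoc, Matrix.sub_mul _ _ (repState V m), h]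
  simp

/-- The normal equation for the gain. For the singular covariance matrix of `X *ᵥ ε` it
holds with the Moore-Penrose inverse, because `X *ᵥ ε` vanishes almost surely in the directions
of the kernel of its covariance matrix, so that nothing is correlated with it there. -/
theorem gain_mul_cov {C : V → Matrix (Fin m) (Fin m) ℝ} (hC : ∀ i, (C i).PosSemidef)
    {R S : Type*} [Fintype R] (A : Matrix S (Fin m × V) ℝ) (X : Matrix R (Fin m × V) ℝ) :
    A * noiseCov C * Xᵀ * pinv (X * noiseCov C * Xᵀ) * (X * noiseCov C * Xᵀ)
      = A * noiseCov C * Xᵀ := by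
  classical
  set S' := X * noiseCov C * Xᵀ with hS
  have hSt : S'ᵀ = S' := by
    rw [hS, Matrix.transpose_mul, Matrix.transpose_mul, transpose_noiseCov]
    simp [Matrix.mul_assoc]
  have h1 := (pinv_spec S').mul_mul_self
  have h0 : (1 - pinv S' * S')ᵀ * X * noiseCov C = 0 := by
    apply mul_noiseCov_eq_zero hC
    have : S' * (1 - pinv S' * S') = 0 := by
      rw [Matrix.mul_sub, ← Matrix.mul_assoc, h1]; simp
    calc _ = (1 - pinv S' * S')ᵀ * (S' * (1 - pinv S' * S')) := by
          rw [hS]; simp only [Matrix.transpose_mul, Matrix.transpose_transpose, Matrix.mul_assoc]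
      _ = 0 := by rw [this, Matrix.mul_zero]
  have h2 := congrArg Matrix.transpose h0
  rw [Matrix.transpose_mul, Matrix.transpose_mul, transpose_noiseCov, Matrix.transpose_transpose,
    Matrix.transpose_zero, ← Matrix.mul_assoc, Matrix.mul_sub, Matrix.mul_one, sub_eq_zero] at h2
  have h3 := congrArg (A * ·) h2
  simp only [Matrix.mul_assoc] at h3 ⊢
  exact h3.symm

end EstimateAlgebra

/-! ### The update of an estimate -/

section EstimateStep

theorem mul_mul_mul_assoc {a b c d e : Type*} [Fintype b] [Fintype c] [Fintype d]
    (G : Matrix a b ℝ) (H : Matrix b c ℝ) (A : Matrix c d ℝ) (B : Matrix d e ℝ) :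
    G * (H * A) * B = G * (H * (A * B)) := by
  simp only [Matrix.mul_assoc]

theorem mul_mul_mul_mul_assoc {a b c d e f : Type*} [Fintype b] [Fintype c] [Fintype d] [Fintype e]
    (G : Matrix a b ℝ) (H : Matrix b c ℝ) (A : Matrix c d ℝ) (B : Matrix d e ℝ)
    (D : Matrix e f ℝ) : G * (H * A) * B * D = G * (H * (A * B * D)) := by
  simp only [Matrix.mul_assoc]

variable {V : Type*} [Fintype V] [DecidableEq V] {m : ℕ}
  {C : V → Matrix (Fin m) (Fin m) ℝ} {i : V} {E : Estimate V m} {R S : Type*}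

theorem Estimate.IsLMMSE.innovation_cov (hE : E.IsLMMSE C i) (H : Matrix R (Fin m × V) ℝ) :
    H * E.Mxx * Hᵀ = (H * (1 - E.L)) * noiseCov C * (H * (1 - E.L))ᵀ := by
  rw [hE.Mxx_eq, Matrix.transpose_mul]
  simp only [Matrix.mul_assoc]

theorem ErrorUncorrelated.transpose_eq_zero {N : Matrix S (Fin m × V) ℝ}
    (hN : ErrorUncorrelated C i E N) : N * relSignal m i * noiseCov C * (1 - E.L)ᵀ = 0 := by
  have := congrArg Matrix.transpose hN.1
  rwa [Matrix.transpose_mul, Matrix.transpose_mul (1 - E.L), transpose_noiseCov,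
    Matrix.transpose_transpose, Matrix.transpose_zero, ← Matrix.mul_assoc] at this

variable [Fintype R]

theorem Estimate.step_L (E : Estimate V m) (H : Matrix R (Fin m × V) ℝ) :
    (E.step H).L = E.L + E.Mxx * Hᵀ * pinv (H * E.Mxx * Hᵀ) * (H * (1 - E.L)) := by
  simp only [Estimate.step]
  rw [Matrix.mul_sub H, Matrix.mul_one]

theorem Estimate.one_sub_step_L (E : Estimate V m) (H : Matrix R (Fin m × V) ℝ) :
    1 - (E.step H).L
      = (1 - E.L) - E.Mxx * Hᵀ * pinv (H * E.Mxx * Hᵀ) * (H * (1 - E.L)) := by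
  rw [Estimate.step_L]
  abel

theorem Estimate.step_Q (E : Estimate V m) (H : Matrix R (Fin m × V) ℝ) :
    (E.step H).Q = E.Q + E.Mθx * Hᵀ * pinv (H * E.Mxx * Hᵀ) * (H * (1 - E.L)) := by
  simp only [Estimate.step]
  rw [Matrix.mul_sub H, Matrix.mul_one]

/-- Orthogonality principle for the signals: the error after the update is uncorrelated with the
innovation `H *ᵥ (x - E.L *ᵥ x)`. -/
theorem Estimate.IsLMMSE.step_L_orth (hC : ∀ i, (C i).PosSemidef) (hE : E.IsLMMSE C i)
    (H : Matrix R (Fin m × V) ℝ) :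
    (1 - (E.step H).L) * noiseCov C * (H * (1 - E.L))ᵀ = 0 := by
  rw [Estimate.one_sub_step_L, hE.innovation_cov, Matrix.sub_mul, Matrix.sub_mul, hE.Mxx_eq]
  have h := gain_mul_cov hC (1 - E.L) (H * (1 - E.L))
  rw [sub_eq_zero, ← h]
  simp only [Matrix.mul_assoc, Matrix.transpose_mul]

/-- Orthogonality principle for the state of the world. -/
theorem Estimate.IsLMMSE.step_Q_orth (hC : ∀ i, (C i).PosSemidef) (hE : E.IsLMMSE C i)
    (H : Matrix R (Fin m × V) ℝ) :
    (E.step H).Q * noiseCov C * (H * (1 - E.L))ᵀ = 0 := by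
  rw [Estimate.step_Q, hE.innovation_cov, Matrix.add_mul, Matrix.add_mul, hE.Mθx_eq]
  have h := gain_mul_cov hC E.Q (H * (1 - E.L))
  rw [← eq_neg_iff_add_eq_zero, ← h]
  simp only [Matrix.mul_assoc, Matrix.transpose_mul, Matrix.neg_mul, neg_neg]

/-- What the error is uncorrelated with before an update, it is uncorrelated with afterwards. -/
theorem ErrorUncorrelated.step {N : Matrix S (Fin m × V) ℝ}
    (hN : ErrorUncorrelated C i E N) (H : Matrix R (Fin m × V) ℝ) :
    ErrorUncorrelated C i (E.step H) N := by
  have h := hN.1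
  constructor
  · rw [Estimate.one_sub_step_L, Matrix.sub_mul, Matrix.sub_mul, hN.1]
    rw [mul_mul_mul_mul_assoc, h]
    simp
  · rw [Estimate.step_Q, Matrix.add_mul, Matrix.add_mul, hN.2]
    rw [mul_mul_mul_mul_assoc, h]
    simp

theorem Estimate.IsLMMSE.uncorrelated_innovation (hC : ∀ i, (C i).PosSemidef)
    (hE : E.IsLMMSE C i) (H : Matrix R (Fin m × V) ℝ) :
    ErrorUncorrelated C i (E.step H) (H * (1 - E.L)) := by
  rw [ErrorUncorrelated, Matrix.mul_assoc H, sub_mul_relSignal hE.L_mul_repState]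
  exact ⟨hE.step_L_orth hC H, hE.step_Q_orth hC H⟩

/-- After an update the error is uncorrelated with the observation. -/
theorem Estimate.IsLMMSE.uncorrelated_observation (hC : ∀ i, (C i).PosSemidef)
    (hE : E.IsLMMSE C i) (H : Matrix R (Fin m × V) ℝ) :
    ErrorUncorrelated C i (E.step H) H := by
  have h := (hE.uncorrelated_innovation hC H).add ((hE.uncorrelated_L.step H).mul_left H)
  rwa [← Matrix.mul_add, sub_add_cancel, Matrix.mul_one] at h

/-- The covariance matrix with the updated error equals the one with the old error, for anything
that is uncorrelated with the innovation. -/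
theorem Estimate.mul_one_sub_step_L_transpose {A : Matrix S (Fin m × V) ℝ}
    {H : Matrix R (Fin m × V) ℝ} (hA : A * (H * (1 - E.L))ᵀ = 0) :
    A * (1 - (E.step H).L)ᵀ = A * (1 - E.L)ᵀ := by
  rw [Estimate.one_sub_step_L, Matrix.transpose_sub, Matrix.mul_sub, Matrix.transpose_mul _ (H * _),
    ← Matrix.mul_assoc A, hA, Matrix.zero_mul, sub_zero]

theorem Estimate.IsLMMSE.step (hC : ∀ i, (C i).PosSemidef) (hE : E.IsLMMSE C i)
    (H : Matrix R (Fin m × V) ℝ) : (E.step H).IsLMMSE C i := by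
  have h0 : (1 - E.L) * repState V m = 0 := by
    rw [Matrix.sub_mul, hE.L_mul_repState, Matrix.one_mul, sub_self]
  have hL := hE.step_L_orth hC H
  have hQ := hE.step_Q_orth hC H
  refine ⟨?_, ?_, ?_, ?_, ?_, ?_, ?_⟩
  · rw [← sub_eq_zero, ← neg_eq_zero, neg_sub]
    calc _ = (1 - (E.step H).L) * repState V m := by rw [Matrix.sub_mul, Matrix.one_mul]
      _ = 0 := by
        rw [Estimate.one_sub_step_L, Matrix.sub_mul, h0, mul_mul_mul_assoc, h0]
        simp
  · rw [Estimate.step_Q, Matrix.add_mul, hE.Q_mul_repState, mul_mul_mul_assoc, h0]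
    simp
  · rw [Estimate.mul_one_sub_step_L_transpose hL, Estimate.one_sub_step_L,
      Matrix.sub_mul, Matrix.sub_mul, ← hE.Mxx_eq]
    rw [mul_mul_mul_mul_assoc, ← hE.Mxx_eq]
    simp only [Estimate.step, Matrix.mul_assoc]
  · rw [Estimate.mul_one_sub_step_L_transpose hQ, Estimate.step_Q, Matrix.add_mul,
      Matrix.add_mul, neg_add, ← hE.Mθx_eq]
    rw [mul_mul_mul_mul_assoc, ← hE.Mxx_eq]
    simp only [Estimate.step, Matrix.mul_assoc, sub_eq_add_neg]
  · have h1 : (E.step H).Q * noiseCov C * (E.step H).Qᵀ = (E.step H).Q * noiseCov C * E.Qᵀ := by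
      generalize (E.step H).Q * noiseCov C = A at hQ ⊢
      rw [Estimate.step_Q, Matrix.transpose_add, Matrix.mul_add, Matrix.transpose_mul _ (H * _),
        ← Matrix.mul_assoc A, hQ, Matrix.zero_mul, add_zero]
    rw [h1, Estimate.step_Q, Matrix.add_mul, Matrix.add_mul, ← hE.Mθθ_eq]
    have h2 : E.Mθxᵀ = -((1 - E.L) * noiseCov C * E.Qᵀ) := by
      rw [hE.Mθx_eq, Matrix.transpose_neg, Matrix.transpose_mul, Matrix.transpose_mul,
        transpose_noiseCov]
      simp [Matrix.mul_assoc]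
    rw [mul_mul_mul_mul_assoc]
    simp only [Estimate.step, h2, Matrix.mul_assoc, Matrix.mul_neg, sub_neg_eq_add]
  · have h := (hE.uncorrelated_L.step H).add ((hE.uncorrelated_innovation hC H).mul_left
      (E.Mxx * Hᵀ * pinv (H * E.Mxx * Hᵀ)))
    rwa [← Estimate.step_L] at h
  · have h := (hE.uncorrelated_Q.step H).add ((hE.uncorrelated_innovation hC H).mul_left
      (E.Mθx * Hᵀ * pinv (H * E.Mxx * Hᵀ)))
    rwa [← Estimate.step_Q] at h

/-- The values of both estimates at an arbitrary vector of signals are already attained in the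
support of the signals. This matters when the noise is degenerate. -/
def Estimate.AttainedOnSupport (C : V → Matrix (Fin m) (Fin m) ℝ) (E : Estimate V m) : Prop :=
  ∀ x, ∃ y z, E.L *ᵥ (repState V m *ᵥ y + noiseCov C *ᵥ z) = E.L *ᵥ x ∧
    E.Q *ᵥ (repState V m *ᵥ y + noiseCov C *ᵥ z) = E.Q *ᵥ x

theorem Estimate.attainedOnSupport_init (C : V → Matrix (Fin m) (Fin m) ℝ) (i : V) :
    (Estimate.init C i).AttainedOnSupport C := by
  intro x
  refine ⟨ownSignal m i *ᵥ x, 0, ?_⟩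
  rw [mulVec_zero, add_zero, Estimate.init_L, Estimate.init_Q, ← mulVec_mulVec, ← mulVec_mulVec,
    mulVec_mulVec _ (ownSignal m i) (repState V m), ownSignal_mul_repState, one_mulVec]
  exact ⟨rfl, rfl⟩

theorem Estimate.AttainedOnSupport.step (hE : E.IsLMMSE C i) (hS : E.AttainedOnSupport C)
    (H : Matrix R (Fin m × V) ℝ) : (E.step H).AttainedOnSupport C := by
  intro x
  obtain ⟨y, z, hL, hQ⟩ := hS x
  set x' := repState V m *ᵥ y + noiseCov C *ᵥ z with hx'
  set S := H * E.Mxx * Hᵀ with hSdef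
  -- A perturbation along `Mxx * Hᵀ` shifts the innovation without changing the old estimates.
  set w := Hᵀ *ᵥ (pinv S *ᵥ (H *ᵥ (x - x'))) with hw
  set s := relSignal m i *ᵥ (noiseCov C *ᵥ ((1 - E.L)ᵀ *ᵥ w)) with hs
  have hLs : E.L *ᵥ s = 0 := by
    have := hE.uncorrelated_L.transpose_eq_zero
    simp only [hs, mulVec_mulVec, ← Matrix.mul_assoc, this, zero_mulVec]
  have hQs : E.Q *ᵥ s = 0 := by
    have := hE.uncorrelated_Q.transpose_eq_zero
    simp only [hs, mulVec_mulVec, ← Matrix.mul_assoc, this, zero_mulVec]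
  have hsM : s = E.Mxx *ᵥ w := by
    have h1 : s = (1 - E.L) *ᵥ s := by rw [Matrix.sub_mulVec, hLs, one_mulVec, sub_zero]
    rw [h1, hs, mulVec_mulVec, sub_mul_relSignal hE.L_mul_repState, hE.Mxx_eq]
    simp only [mulVec_mulVec, Matrix.mul_assoc]
  have hinn : pinv S *ᵥ (H *ᵥ s) = pinv S *ᵥ (H *ᵥ (x - x')) := by
    have := (pinv_spec S).self_mul_mul
    rw [hsM, hw]
    simp only [mulVec_mulVec, ← Matrix.mul_assoc]
    rw [Matrix.mul_assoc (pinv S) H, Matrix.mul_assoc (pinv S) (H * _), ← hSdef, this]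
  -- The perturbed point lies in the support, since `relSignal` only subtracts a replicated vector.
  set z' := noiseCov C *ᵥ ((1 - E.L)ᵀ *ᵥ w) with hz'
  refine ⟨y - ownSignal m i *ᵥ z', z + (1 - E.L)ᵀ *ᵥ w, ?_⟩
  have hpt : repState V m *ᵥ (y - ownSignal m i *ᵥ z') + noiseCov C *ᵥ (z + (1 - E.L)ᵀ *ᵥ w)
      = x' + s := by
    rw [hs, relSignal, Matrix.sub_mulVec, one_mulVec, mulVec_add, mulVec_sub, ← mulVec_mulVec, hx',
      ← hz']
    abel
  have hinn' : pinv S *ᵥ (H *ᵥ ((1 - E.L) *ᵥ (x' + s))) = pinv S *ᵥ (H *ᵥ ((1 - E.L) *ᵥ x)) := by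
    have : (1 - E.L) *ᵥ (x' + s) = (1 - E.L) *ᵥ x - (x - x') + s := by
      simp only [Matrix.sub_mulVec, one_mulVec, mulVec_add, hLs, hL]
      abel
    rw [this, mulVec_add, mulVec_sub, mulVec_add, mulVec_sub, hinn]
    abel
  have hLeq : ∀ v, (E.step H).L *ᵥ v
      = E.L *ᵥ v + (E.Mxx * Hᵀ) *ᵥ (pinv S *ᵥ (H *ᵥ ((1 - E.L) *ᵥ v))) := by
    intro v
    simp only [Estimate.step_L, Matrix.add_mulVec, mulVec_mulVec, Matrix.mul_assoc, ← hSdef]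
  have hQeq : ∀ v, (E.step H).Q *ᵥ v
      = E.Q *ᵥ v + (E.Mθx * Hᵀ) *ᵥ (pinv S *ᵥ (H *ᵥ ((1 - E.L) *ᵥ v))) := by
    intro v
    simp only [Estimate.step_Q, Matrix.add_mulVec, mulVec_mulVec, Matrix.mul_assoc, ← hSdef]
  rw [hpt, hLeq, hLeq, hQeq, hQeq, hinn', mulVec_add E.L x', mulVec_add E.Q x',
    hLs, hQs, add_zero, add_zero, hL, hQ]
  exact ⟨rfl, rfl⟩

end EstimateStep

/-! ### Disintegration of σ-finite measures -/

section Disintegration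

variable {α β γ S T : Type*} [MeasurableSpace α] [MeasurableSpace β] [MeasurableSpace γ]
  [MeasurableSpace S] [MeasurableSpace T]

theorem restrict_compProd_univ {μ : Measure α} [SFinite μ] (κ : Kernel α β) [IsFiniteKernel κ]
    {s : Set α} (hs : MeasurableSet s) :
    (μ.restrict s) ⊗ₘ κ = (μ ⊗ₘ κ).restrict (s ×ˢ Set.univ) := by
  ext t ht
  have hu : MeasurableSet (s ×ˢ (Set.univ : Set β)) := hs.prod MeasurableSet.univ
  rw [Measure.restrict_apply ht, Measure.compProd_apply ht, Measure.compProd_apply (ht.inter hu),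
    ← lintegral_indicator hs]
  congr with a
  by_cases ha : a ∈ s <;> simp [ha, Set.preimage]

/-- Two disintegrations of the same measure with respect to a `σ`-finite marginal agree almost
everywhere. -/
theorem ae_eq_of_compProd_eq_of_sigmaFinite
    [MeasurableSpace.CountableOrCountablyGenerated α β] {μ : Measure α} [SigmaFinite μ]
    {κ η : Kernel α β} [IsFiniteKernel κ] [IsFiniteKernel η] (h : μ ⊗ₘ κ = μ ⊗ₘ η) :
    ∀ᵐ a ∂μ, κ a = η a := by
  refine ae_of_forall_measure_lt_top_ae_restrict _ fun s hs hμs => ?_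
  have : IsFiniteMeasure (μ.restrict s) := isFiniteMeasure_restrict.2 hμs.ne
  refine Kernel.ae_eq_of_compProd_eq ?_
  rw [restrict_compProd_univ κ hs, restrict_compProd_univ η hs, h]

/-- The kernel that translates the measure `ν` by `ℓ a`, for a measurable function `ℓ`. -/
def translateKernel [Add S] [MeasurableAdd₂ S] (ν : Measure S) (ℓ : α → S) : Kernel α S :=
  (Kernel.id ×ₖ Kernel.const α ν).map fun p => ℓ p.1 + p.2

variable [Add S] [MeasurableAdd₂ S]

theorem translateKernel_apply (ν : Measure S) [IsProbabilityMeasure ν] (ℓ : α → S)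
    (hℓ : Measurable ℓ) (a : α) : translateKernel ν ℓ a = ν.map fun s => ℓ a + s := by
  rw [translateKernel, Kernel.map_apply _ (by fun_prop), Kernel.prod_apply, Kernel.id_apply,
    Kernel.const_apply, Measure.dirac_prod, Measure.map_map (by fun_prop) (by fun_prop)]
  rfl

instance (ν : Measure S) [IsProbabilityMeasure ν] (ℓ : α → S) :
    IsFiniteKernel (translateKernel ν ℓ) := by
  unfold translateKernel
  infer_instance

theorem prod_map_add_eq_compProd (μ : Measure α) [SFinite μ] (ν : Measure S)
    [IsProbabilityMeasure ν] (ℓ : α → S) (hℓ : Measurable ℓ) :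
    (μ.prod ν).map (fun p => (p.1, ℓ p.1 + p.2)) = μ ⊗ₘ translateKernel ν ℓ := by
  ext s hs
  have hm : Measurable fun p : α × S => (p.1, ℓ p.1 + p.2) := by fun_prop
  rw [Measure.map_apply hm hs, Measure.prod_apply (hm hs), Measure.compProd_apply hs]
  congr with a
  rw [translateKernel_apply _ _ hℓ, Measure.map_apply (by fun_prop) (measurable_prodMk_left hs)]
  rfl

/-- If the observation `Φ (y, b e)` involves the noise `e` only through `b e`, and the error `ξ e`
is independent of `b e`, then the law of `ℓ (Φ (y, b e)) + ξ e` given the observation is the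
law of the error, translated by `ℓ`. The measure `μ` may be infinite. -/
theorem map_prod_eq_compProd_translateKernel {μ : Measure γ} [SFinite μ] {ν : Measure β}
    [IsProbabilityMeasure ν] {b : β → T} {ξ : β → S} (hb : Measurable b) (hξ : Measurable ξ)
    (hind : IndepFun b ξ ν) {Φ : γ × T → α} (hΦ : Measurable Φ) {ℓ : α → S} (hℓ : Measurable ℓ)
    [IsProbabilityMeasure (ν.map ξ)] :
    (μ.prod ν).map (fun p => (Φ (p.1, b p.2), ℓ (Φ (p.1, b p.2)) + ξ p.2))
      = ((μ.prod ν).map fun p => Φ (p.1, b p.2)) ⊗ₘ translateKernel (ν.map ξ) ℓ := by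
  have : IsProbabilityMeasure (ν.map b) := Measure.isProbabilityMeasure_map hb.aemeasurable
  have h1 : (μ.prod ν).map (fun p => ((p.1, b p.2), ξ p.2))
      = (μ.prod (ν.map b)).prod (ν.map ξ) := by
    have h2 := (indepFun_iff_map_prod_eq_prod_map_map hb.aemeasurable hξ.aemeasurable).1 hind
    rw [← (measurePreserving_prodAssoc μ (ν.map b) (ν.map ξ)).symm.map_eq, ← h2]
    conv_rhs => rw [← Measure.map_id (μ := μ),
      Measure.map_prod_map _ _ measurable_id (hb.prodMk hξ),
      Measure.map_map (MeasurableEquiv.measurable _) (by fun_prop)]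
    rfl
  have h3 : (μ.prod ν).map (fun p => (Φ (p.1, b p.2), ξ p.2))
      = ((μ.prod ν).map fun p => Φ (p.1, b p.2)).prod (ν.map ξ) := by
    have h4 : (μ.prod ν).map (fun p => Φ (p.1, b p.2)) = (μ.prod (ν.map b)).map Φ := by
      conv_rhs => rw [← Measure.map_id (μ := μ), Measure.map_prod_map _ _ measurable_id hb,
        Measure.map_map hΦ (by fun_prop)]
      rfl
    rw [h4]
    conv_rhs => rw [← Measure.map_id (μ := ν.map ξ),
      Measure.map_prod_map _ _ hΦ measurable_id, ← h1,
      Measure.map_map (by fun_prop) (by fun_prop)]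
    rfl
  rw [← prod_map_add_eq_compProd _ _ _ hℓ, ← h3, Measure.map_map (by fun_prop) (by fun_prop)]
  rfl

end Disintegration

/-! ### Linear functions of a Gaussian vector -/

section GaussianVector

variable {ι κ κ' : Type*} [Fintype ι]

theorem measurable_mulVec [Fintype κ] (A : Matrix κ ι ℝ) : Measurable fun e : ι → ℝ => A *ᵥ e :=
  (Continuous.matrix_mulVec continuous_const continuous_id).measurable

theorem memLp_eval {ν : Measure (ι → ℝ)} [IsGaussian ν] (p : ι) :
    MemLp (fun e : ι → ℝ => e p) 2 ν :=
  IsGaussian.memLp_dual ν (ContinuousLinearMap.proj p) 2 (by norm_num)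

theorem covariance_mulVec {ν : Measure (ι → ℝ)} [IsGaussian ν] {Γ : Matrix ι ι ℝ}
    (hΓ : ∀ p q, cov[fun e : ι → ℝ => e p, fun e => e q; ν] = Γ p q)
    (A : Matrix κ ι ℝ) (B : Matrix κ' ι ℝ) (k : κ) (l : κ') :
    cov[fun e => (A *ᵥ e) k, fun e => (B *ᵥ e) l; ν] = (A * Γ * Bᵀ) k l := by
  simp only [mulVec, dotProduct]
  rw [covariance_fun_sum_fun_sum (fun p => (memLp_eval p).const_mul _)
    (fun p => (memLp_eval p).const_mul _)]
  simp only [covariance_const_mul_left, covariance_const_mul_right, hΓ, Matrix.mul_apply,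
    Finset.sum_mul, Matrix.transpose_apply]
  rw [Finset.sum_comm]
  refine Finset.sum_congr rfl fun p _ => Finset.sum_congr rfl fun q _ => ?_
  ring

/-- Uncorrelated linear functions of a Gaussian vector are independent. -/
theorem indepFun_mulVec [Fintype κ] [Fintype κ'] {ν : Measure (ι → ℝ)} [IsGaussian ν]
    {Γ : Matrix ι ι ℝ}
    (hΓ : ∀ p q, cov[fun e : ι → ℝ => e p, fun e => e q; ν] = Γ p q)
    (A : Matrix κ ι ℝ) (B : Matrix κ' ι ℝ) (h : A * Γ * Bᵀ = 0) :
    IndepFun (fun e => A *ᵥ e) (fun e => B *ᵥ e) ν := by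
  refine HasGaussianLaw.indepFun_of_covariance_eval (X := fun k e => (A *ᵥ e) k)
    (Y := fun l e => (B *ᵥ e) l) ?_ ?_
  · exact HasGaussianLaw.map (X := id) IsGaussian.hasGaussianLaw_id
      ((LinearMap.toContinuousLinearMap A.mulVecLin).prod
        (LinearMap.toContinuousLinearMap B.mulVecLin))
  · intro k l
    rw [covariance_mulVec hΓ, h]
    rfl

theorem integrable_mulVec {ν : Measure (ι → ℝ)} [IsGaussian ν] (A : Matrix κ ι ℝ) (k : κ) :
    Integrable (fun e => (A *ᵥ e) k) ν := by
  simp only [mulVec, dotProduct]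
  exact integrable_finsetSum _ fun p _ => ((memLp_eval p).integrable (by norm_num)).const_mul _

theorem integral_add_mulVec {ν : Measure (ι → ℝ)} [IsGaussian ν]
    (hν : ∀ p, ∫ e : ι → ℝ, e p ∂ν = 0) (c : ℝ) (A : Matrix κ ι ℝ) (k : κ) :
    ∫ e, (c + (A *ᵥ e) k) ∂ν = c := by
  rw [integral_add (integrable_const _) (integrable_mulVec A k)]
  simp only [mulVec, dotProduct]
  rw [integral_finsetSum _ fun p _ => ((memLp_eval p).integrable (by norm_num)).const_mul _]
  simp [integral_const_mul, hν]

theorem covariance_add_mulVec {ν : Measure (ι → ℝ)} [IsGaussian ν] {Γ : Matrix ι ι ℝ}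
    (hΓ : ∀ p q, cov[fun e : ι → ℝ => e p, fun e => e q; ν] = Γ p q)
    (c d : ℝ) (A : Matrix κ ι ℝ) (B : Matrix κ' ι ℝ) (k : κ) (l : κ') :
    cov[fun e => c + (A *ᵥ e) k, fun e => d + (B *ᵥ e) l; ν] = (A * Γ * Bᵀ) k l := by
  rw [covariance_const_add_left (integrable_mulVec A k),
    covariance_const_add_right (integrable_mulVec B l), covariance_mulVec hΓ]

end GaussianVector

/-! ### The improper prior -/

section Prior

variable {V : Type*} {m : ℕ}

theorem measurable_stack :
    Measurable fun (ε : V → EuclideanSpace ℝ (Fin m)) (p : Fin m × V) => ε p.2 p.1 := by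
  fun_prop

variable [Fintype V]

/-- The law of the noise, stacked in the same order as the private signals. -/
def stackedNoise (C : V → Matrix (Fin m) (Fin m) ℝ) : Measure (Fin m × V → ℝ) :=
  (noise C).map fun ε p => ε p.2 p.1

instance (C : V → Matrix (Fin m) (Fin m) ℝ) : IsProbabilityMeasure (noise C) := by
  unfold noise; infer_instance

theorem hasGaussianLaw_noise_eval (C : V → Matrix (Fin m) (Fin m) ℝ) (a : V) :
    HasGaussianLaw (fun ε : V → EuclideanSpace ℝ (Fin m) => ε a) (noise C) where
  isGaussian_map := by
    have : (noise C).map (fun ε => ε a) = multivariateGaussian 0 (C a) :=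
      (measurePreserving_eval _ a).map_eq
    rw [this]; infer_instance

instance (C : V → Matrix (Fin m) (Fin m) ℝ) : IsGaussian (stackedNoise C) := by
  have hind : iIndepFun (fun (a : V) (ε : V → EuclideanSpace ℝ (Fin m)) => ε a) (noise C) :=
    iIndepFun_pi (X := fun _ x => x) (fun _ => by fun_prop)
  have h := hind.hasGaussianLaw (hasGaussianLaw_noise_eval C)
  have h2 := h.map (ContinuousLinearMap.pi fun p : Fin m × V =>
    (EuclideanSpace.proj (𝕜 := ℝ) p.1).comp (ContinuousLinearMap.proj (R := ℝ)
      (φ := fun _ : V => EuclideanSpace ℝ (Fin m)) p.2))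
  exact h2.isGaussian_map

theorem stackedNoise_integral_eval (C : V → Matrix (Fin m) (Fin m) ℝ) (p : Fin m × V) :
    ∫ e, e p ∂stackedNoise C = 0 := by
  rw [stackedNoise, integral_map measurable_stack.aemeasurable
    (measurable_pi_apply p).aestronglyMeasurable]
  have h := (measurePreserving_eval (fun a => multivariateGaussian 0 (C a)) p.2).map_eq
  have h2 : ∫ x : EuclideanSpace ℝ (Fin m), x p.1 ∂multivariateGaussian 0 (C p.2) = 0 := by
    have h3 := (EuclideanSpace.proj (𝕜 := ℝ) p.1).integral_comp_comm
      (μ := multivariateGaussian 0 (C p.2)) IsGaussian.integrable_fun_id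
    rw [integral_id_multivariateGaussian] at h3
    exact h3
  rw [← h, integral_map (measurable_pi_apply _).aemeasurable (by fun_prop)] at h2
  exact h2

theorem stackedNoise_cov [DecidableEq V] {C : V → Matrix (Fin m) (Fin m) ℝ}
    (hC : ∀ i, (C i).PosSemidef) (hCdiag : ∀ i, (C i).IsDiag) (p q : Fin m × V) :
    cov[fun e => e p, fun e => e q; stackedNoise C] = noiseCov C p q := by
  rw [stackedNoise, covariance_map_fun (measurable_pi_apply p).aestronglyMeasurable
    (measurable_pi_apply q).aestronglyMeasurable measurable_stack.aemeasurable]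
  obtain ⟨k, a⟩ := p
  obtain ⟨l, b⟩ := q
  by_cases hab : a = b
  · subst hab
    have h := (measurePreserving_eval (fun a => multivariateGaussian 0 (C a)) a).map_eq
    have h2 := covariance_eval_multivariateGaussian (μ := 0) (hC a) k l
    have h3 := covariance_map_fun (X := fun x : EuclideanSpace ℝ (Fin m) => x k)
      (Y := fun x : EuclideanSpace ℝ (Fin m) => x l) (Z := Function.eval a)
      (μ := Measure.pi fun a => multivariateGaussian 0 (C a)) (by fun_prop) (by fun_prop)
      (measurable_pi_apply _).aemeasurable
    rw [h] at h3
    refine h3.symm.trans (h2.trans ?_)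
    by_cases hkl : k = l
    · simp [noiseCov, hkl]
    · simp [noiseCov, hkl, hCdiag a hkl]
  · have hind : iIndepFun (fun (a : V) (ε : V → EuclideanSpace ℝ (Fin m)) => ε a) (noise C) :=
      iIndepFun_pi (X := fun _ x => x) (fun _ => by fun_prop)
    have h1 := (hind.indepFun hab).comp (φ := fun x : EuclideanSpace ℝ (Fin m) => x k)
      (ψ := fun x : EuclideanSpace ℝ (Fin m) => x l) (by fun_prop) (by fun_prop)
    have hL : ∀ (k : Fin m) (a : V), MemLp (fun ε : V → EuclideanSpace ℝ (Fin m) => ε a k) 2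
        (noise C) := fun k a =>
      ((hasGaussianLaw_noise_eval C a).map_fun (EuclideanSpace.proj (𝕜 := ℝ) k)).memLp_two
    rw [noiseCov, diagonal_apply_ne _ fun h => hab (congrArg Prod.snd h)]
    exact h1.covariance_eq_zero (hL k a) (hL l b)

theorem prior_eq_map (C : V → Matrix (Fin m) (Fin m) ℝ) :
    prior C = ((volume : Measure (Fin m → ℝ)).prod (stackedNoise C)).map
      fun ω => (ω.1, repState V m *ᵥ ω.1 + ω.2) := by
  rw [stackedNoise]
  conv_rhs => rw [← Measure.map_id (μ := (volume : Measure (Fin m → ℝ)))]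
  rw [Measure.map_prod_map _ _ measurable_id measurable_stack,
    Measure.map_map ?_ (by fun_prop), prior]
  · congr 1
    funext ω
    simp only [Function.comp, Prod.map, repState_mulVec]
    rfl
  · simp only [repState_mulVec]
    fun_prop

theorem measurable_ownCoordinates [DecidableEq V] (i : V) :
    Measurable fun ω : State V m =>
      (ω.1 - ownSignal m i *ᵥ ω.2, repState V m *ᵥ ω.1 + relSignal m i *ᵥ ω.2) :=
  (measurable_fst.sub ((measurable_mulVec _).comp measurable_snd)).prodMk
    (((measurable_mulVec _).comp measurable_fst).add ((measurable_mulVec _).comp measurable_snd))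

/-- The prior in terms of the signal `y` of agent `i` and of the noise: `y` is uniformly
distributed and independent of the noise, because the uniform prior is translation invariant. -/
theorem prior_eq_map_own [DecidableEq V] (C : V → Matrix (Fin m) (Fin m) ℝ) (i : V) :
    prior C = ((volume : Measure (Fin m → ℝ)).prod (stackedNoise C)).map
      fun ω => (ω.1 - ownSignal m i *ᵥ ω.2, repState V m *ᵥ ω.1 + relSignal m i *ᵥ ω.2) := by
  set ν := stackedNoise C
  have hmp : MeasurePreserving
      (fun ω : (Fin m × V → ℝ) × (Fin m → ℝ) => (ω.1, ω.2 - ownSignal m i *ᵥ ω.1))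
      (ν.prod volume) (ν.prod volume) :=
    (MeasurePreserving.id ν).skew_product (g := fun e y => y - ownSignal m i *ᵥ e)
      (measurable_snd.sub ((measurable_mulVec _).comp measurable_fst))
      (ae_of_all _ fun e => map_sub_right_eq_self _ _)
  have hmp' := (Measure.measurePreserving_swap (μ := ν) (ν := volume)).comp
    (hmp.comp (Measure.measurePreserving_swap (μ := (volume : Measure (Fin m → ℝ))) (ν := ν)))
  rw [prior_eq_map, ← hmp'.map_eq, Measure.map_map ?_ hmp'.measurable, hmp'.map_eq]
  · congr 1
    funext ω
    simp only [Function.comp, Prod.swap, relSignal, mulVec_sub, Matrix.sub_mulVec, one_mulVec,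
      mulVec_mulVec]
    congr 1
    abel
  · exact measurable_fst.prodMk
      (((measurable_mulVec _).comp measurable_fst).add measurable_snd)

theorem ownSignal_mulVec_add [DecidableEq V] (i : V) (y : Fin m → ℝ) (e : Fin m × V → ℝ) :
    ownSignal m i *ᵥ (repState V m *ᵥ y + relSignal m i *ᵥ e) = y := by
  rw [mulVec_add, mulVec_mulVec, mulVec_mulVec, ownSignal_mul_repState, ownSignal_mul_relSignal,
    one_mulVec, zero_mulVec, add_zero]

end Prior

/-! ### Histories under linear strategies -/

section LinearHistory

variable {V : Type*} [Fintype V] [DecidableEq V] {m : ℕ}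
  (G : SimpleGraph V) [DecidableRel G.Adj] (C : V → Matrix (Fin m) (Fin m) ℝ)
  (U : V → ℕ → Matrix (Fin m) (Fin m × V) ℝ)

/-- The matrix that maps the private signals to the actions that agent `i` observes at time `t`,
when all agents play the linear strategies with coefficients `U`. -/
def stageObs (t : ℕ) (i : V) : Matrix (G.neighborSet i × Fin m) (Fin m × V) ℝ :=
  obsMatrix G (fun j => U j t) (fun j => (estimates G C U t j).L) i

/-- The history of agent `i` as a linear function of the private signals `x`, for actions
`U j u *ᵥ (L j u *ᵥ x)`. -/
def linearHistory (i : V) (t : ℕ) (x : Fin m × V → ℝ) : History G m i t :=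
  (fun n => x (n, i), fun u j => U j u *ᵥ ((estimates G C U u j).L *ᵥ x))

theorem stageObs_mulVec (t : ℕ) (i : V) (x : Fin m × V → ℝ) (r : G.neighborSet i × Fin m) :
    (stageObs G C U t i *ᵥ x) r = (U r.1 t *ᵥ ((estimates G C U t r.1).L *ᵥ x)) r.2 := by
  rw [mulVec_mulVec]
  rfl

theorem estimates_succ (t : ℕ) (i : V) :
    estimates G C U (t + 1) i = (estimates G C U t i).step (stageObs G C U t i) := rfl

variable {C} in
theorem estimates_isLMMSE (hC : ∀ i, (C i).PosSemidef) (hCdiag : ∀ i, (C i).IsDiag) (t : ℕ)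
    (i : V) : (estimates G C U t i).IsLMMSE C i := by
  induction t with
  | zero => exact Estimate.isLMMSE_init hCdiag i
  | succ t ih => exact ih.step hC _

variable {C} in
theorem estimates_attainedOnSupport (hC : ∀ i, (C i).PosSemidef) (hCdiag : ∀ i, (C i).IsDiag)
    (t : ℕ) (i : V) : (estimates G C U t i).AttainedOnSupport C := by
  induction t with
  | zero => exact Estimate.attainedOnSupport_init C i
  | succ t ih => exact ih.step (estimates_isLMMSE G U hC hCdiag t i) _

variable {C} in
theorem estimates_uncorrelated_past (hC : ∀ i, (C i).PosSemidef) (hCdiag : ∀ i, (C i).IsDiag)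
    {u t : ℕ} (hut : u < t) (i : V) :
    ErrorUncorrelated C i (estimates G C U t i) (stageObs G C U u i) := by
  induction t, hut using Nat.le_induction with
  | base => exact (estimates_isLMMSE G U hC hCdiag u i).uncorrelated_observation hC _
  | succ t _ ih => exact ih.step _

/-- The estimates are functions of the history. -/
theorem exists_estimate_of_linearHistory (t : ℕ) (i : V) :
    ∃ ℓ : History G m i t → State V m, Measurable ℓ ∧ ∀ x, ℓ (linearHistory G C U i t x)
      = ((estimates G C U t i).Q *ᵥ x, (estimates G C U t i).L *ᵥ x) := by
  induction t with
  | zero =>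
    refine ⟨fun h => (h.1, repState V m *ᵥ h.1),
      measurable_fst.prodMk ((measurable_mulVec _).comp measurable_fst), fun x => ?_⟩
    have h : (linearHistory G C U i 0 x).1 = ownSignal m i *ᵥ x := (ownSignal_mulVec i x).symm
    have h' : (estimates G C U 0 i).L = repState V m * ownSignal m i := Estimate.init_L C i
    simp only [h, h', mulVec_mulVec]
    rfl
  | succ t ih =>
    obtain ⟨ℓ, hℓ, hx⟩ := ih
    set E := estimates G C U t i with hE
    set H := stageObs G C U t i with hH
    have hr : Measurable fun h : History G m i (t + 1) => ℓ (h.1, fun u => h.2 u.castSucc) :=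
      hℓ.comp (by fun_prop)
    have hi : Measurable fun h : History G m i (t + 1) =>
        (fun r : G.neighborSet i × Fin m => h.2 (Fin.last t) r.1 r.2)
          - H *ᵥ (ℓ (h.1, fun u => h.2 u.castSucc)).2 :=
      Measurable.sub (by fun_prop) ((measurable_mulVec H).comp hr.snd)
    refine ⟨_, (hr.fst.add
      ((measurable_mulVec (E.Mθx * Hᵀ * pinv (H * E.Mxx * Hᵀ))).comp hi)).prodMk
      (hr.snd.add ((measurable_mulVec (E.Mxx * Hᵀ * pinv (H * E.Mxx * Hᵀ))).comp hi)), fun x => ?_⟩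
    have hpast : ((linearHistory G C U i (t + 1) x).1,
        fun u : Fin t => (linearHistory G C U i (t + 1) x).2 u.castSucc)
        = linearHistory G C U i t x := rfl
    have hnow : (fun r : G.neighborSet i × Fin m =>
        (linearHistory G C U i (t + 1) x).2 (Fin.last t) r.1 r.2) = H *ᵥ x :=
      funext fun r => (stageObs_mulVec G C U t i x r).symm
    simp only [Function.comp, hpast, hnow, hx, estimates_succ, ← hE, ← hH, Estimate.step_L,
      Estimate.step_Q, Pi.add_apply]
    simp only [Matrix.add_mulVec, ← mulVec_mulVec, Matrix.sub_mulVec, one_mulVec, mulVec_sub]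

end LinearHistory

/-! ### The Gaussian belief -/

section Belief

variable {V : Type*} [Fintype V] [DecidableEq V] {m : ℕ}

/-- The estimation error of `(θ, x)` as a linear function of the noise. -/
def errorMap (E : Estimate V m) : (Fin m × V → ℝ) →L[ℝ] State V m :=
  (LinearMap.toContinuousLinearMap (-E.Q).mulVecLin).prod
    (LinearMap.toContinuousLinearMap (1 - E.L).mulVecLin)

theorem errorMap_apply (E : Estimate V m) (e : Fin m × V → ℝ) :
    errorMap E e = ((-E.Q) *ᵥ e, (1 - E.L) *ᵥ e) := rfl

/-- The belief of an agent with estimate `E` when the private signals are `x`: the law of the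
estimation error, translated to the estimated value. -/
def gaussianBelief (C : V → Matrix (Fin m) (Fin m) ℝ) (E : Estimate V m) (x : Fin m × V → ℝ) :
    Measure (State V m) :=
  ((stackedNoise C).map (errorMap E)).map fun s => (E.Q *ᵥ x, E.L *ᵥ x) + s

theorem isGaussianBelief_gaussianBelief {C : V → Matrix (Fin m) (Fin m) ℝ}
    (hC : ∀ i, (C i).PosSemidef) (hCdiag : ∀ i, (C i).IsDiag) {i : V} {E : Estimate V m}
    (hE : E.IsLMMSE C i) (x : Fin m × V → ℝ) : IsGaussianBelief (gaussianBelief C E x) E x := by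
  have hmap : gaussianBelief C E x = (stackedNoise C).map fun e =>
      (E.Q *ᵥ x + (-E.Q) *ᵥ e, E.L *ᵥ x + (1 - E.L) *ᵥ e) := by
    rw [gaussianBelief, Measure.map_map (by fun_prop) (by fun_prop)]
    rfl
  have hm : Measurable fun e : Fin m × V → ℝ =>
      (E.Q *ᵥ x + (-E.Q) *ᵥ e, E.L *ᵥ x + (1 - E.L) *ᵥ e) :=
    ((measurable_mulVec _).const_add _).prodMk ((measurable_mulVec _).const_add _)
  have hcov := stackedNoise_cov hC hCdiag
  have h0 := stackedNoise_integral_eval C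
  refine ⟨by unfold gaussianBelief; infer_instance, ?_, ?_, ?_, ?_, ?_⟩
  · funext k
    rw [expState, hmap, integral_map hm.aemeasurable (by fun_prop)]
    exact integral_add_mulVec h0 _ _ k
  · funext k
    rw [expSignals, hmap, integral_map hm.aemeasurable (by fun_prop)]
    exact integral_add_mulVec h0 _ _ k
  · intro p q
    rw [hmap, covariance_map_fun (by fun_prop) (by fun_prop) hm.aemeasurable, hE.Mxx_eq]
    exact covariance_add_mulVec hcov _ _ _ _ p q
  · intro k l
    rw [hmap, covariance_map_fun (by fun_prop) (by fun_prop) hm.aemeasurable, hE.Mθθ_eq]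
    refine (covariance_add_mulVec hcov _ _ _ _ k l).trans ?_
    simp
  · intro k q
    rw [hmap, covariance_map_fun (by fun_prop) (by fun_prop) hm.aemeasurable, hE.Mθx_eq]
    refine (covariance_add_mulVec hcov _ _ _ _ k q).trans ?_
    simp

/-- The innovations that determine the history are independent of the estimation error. -/
theorem indepFun_errorMap {C : V → Matrix (Fin m) (Fin m) ℝ}
    (hC : ∀ i, (C i).PosSemidef) (hCdiag : ∀ i, (C i).IsDiag) {i : V} {E : Estimate V m}
    {R : Type*} [Fintype R] {N : Matrix R (Fin m × V) ℝ} (hN : ErrorUncorrelated C i E N) :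
    IndepFun (fun e => (N * relSignal m i) *ᵥ e) (errorMap E) (stackedNoise C) := by
  have h : fromRows (-E.Q) (1 - E.L) * noiseCov C * (N * relSignal m i)ᵀ = 0 := by
    rw [fromRows_mul, fromRows_mul, hN.1, Matrix.neg_mul, Matrix.neg_mul, hN.2, neg_zero]
    ext (k | k) l <;> rfl
  have h2 := indepFun_mulVec (stackedNoise_cov hC hCdiag) _ _ h
  refine h2.symm.comp (φ := id) (ψ := fun f => (fun k => f (Sum.inl k), fun p => f (Sum.inr p)))
    measurable_id (by fun_prop) |>.congr (ae_of_all _ fun _ => rfl) (ae_of_all _ fun e => ?_)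
  rw [errorMap_apply, Function.comp, fromRows_mulVec]
  rfl

end Belief

/-! ### Identification of the beliefs -/

section Identification

variable {V : Type*} {m : ℕ} {G : SimpleGraph V} {σ : Strategy G m}

theorem action_eq (x : Fin m × V → ℝ) (t : ℕ) (i : V) :
    action G σ x t i = σ i t (history G σ i t x) := by
  rw [action]
  rfl

theorem measurable_action (hσ : ∀ i t, Measurable (σ i t)) (t : ℕ) (i : V) :
    Measurable fun x => action G σ x t i := by
  induction t using Nat.strong_induction_on generalizing i with
  | _ t ih =>
    simp only [action_eq]
    refine (hσ i t).comp (Measurable.prodMk (by fun_prop) ?_)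
    exact measurable_pi_lambda _ fun u => measurable_pi_lambda _ fun j => ih u u.2 j

theorem measurable_history (hσ : ∀ i t, Measurable (σ i t)) (i : V) (t : ℕ) :
    Measurable (history G σ i t) :=
  Measurable.prodMk (by fun_prop) <| measurable_pi_lambda _ fun u => measurable_pi_lambda _ fun j =>
    measurable_action hσ u j

variable [Fintype V] [DecidableEq V]

/-- The law of the history is `σ`-finite, since the own signal is uniformly distributed. -/
theorem sigmaFinite_map_history (C : V → Matrix (Fin m) (Fin m) ℝ)
    (hσ : ∀ i t, Measurable (σ i t)) (i : V) (t : ℕ) :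
    SigmaFinite ((prior C).map fun ω => history G σ i t ω.2) := by
  have hm : Measurable fun ω : State V m => history G σ i t ω.2 :=
    (measurable_history hσ i t).comp measurable_snd
  have h : ((prior C).map fun ω => history G σ i t ω.2).map Prod.fst = volume := by
    have hown : Measurable fun ω : State V m => ownSignal m i *ᵥ ω.2 :=
      (measurable_mulVec _).comp measurable_snd
    have hfst : (Prod.fst ∘ fun ω : State V m => history G σ i t ω.2)
        = fun ω => ownSignal m i *ᵥ ω.2 := funext fun ω => (ownSignal_mulVec i ω.2).symm
    rw [Measure.map_map measurable_fst hm, hfst, prior_eq_map_own C i,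
      Measure.map_map hown (measurable_ownCoordinates i)]
    have hcomp : ((fun ω : State V m => ownSignal m i *ᵥ ω.2) ∘ fun ω : State V m =>
        (ω.1 - ownSignal m i *ᵥ ω.2, repState V m *ᵥ ω.1 + relSignal m i *ᵥ ω.2)) = Prod.fst :=
      funext fun ω => ownSignal_mulVec_add i ω.1 ω.2
    rw [hcomp, Measure.map_fst_prod, measure_univ, one_smul]
  refine SigmaFinite.of_map _ measurable_fst.aemeasurable (f := Prod.fst) ?_
  rw [h]
  infer_instance

variable [DecidableRel G.Adj] {C : V → Matrix (Fin m) (Fin m) ℝ}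
  {P : ∀ (i : V) (t : ℕ), Kernel (History G m i t) (State V m)}
  {U : V → ℕ → Matrix (Fin m) (Fin m × V) ℝ}

/-- If the history is almost surely the one that linear strategies generate, then the belief is the
translated law of the estimation error. -/
theorem ae_belief_eq (hC : ∀ i, (C i).PosSemidef) (hCdiag : ∀ i, (C i).IsDiag)
    (hσ : ∀ i t, Measurable (σ i t)) (hP : IsBeliefSystem G C σ P) {i : V} {t : ℕ}
    (hlin : ∀ᵐ ω ∂prior C, history G σ i t ω.2 = linearHistory G C U i t ω.2) :
    ∀ᵐ ω ∂prior C, P i t (history G σ i t ω.2)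
      = gaussianBelief C (estimates G C U t i) ω.2 := by
  obtain ⟨ℓ, hℓ, hℓx⟩ := exists_estimate_of_linearHistory G C U t i
  set E := estimates G C U t i with hE
  have hlmmse : E.IsLMMSE C i := estimates_isLMMSE G U hC hCdiag t i
  have := hP.markov i t
  have := sigmaFinite_map_history C hσ i t
  have hm : Measurable fun ω : State V m => history G σ i t ω.2 :=
    (measurable_history hσ i t).comp measurable_snd
  -- The past observations, stacked into a single matrix.
  set N : Matrix (Fin t × G.neighborSet i × Fin m) (Fin m × V) ℝ :=
    Matrix.of fun r => stageObs G C U r.1 i r.2 with hN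
  have hNunc : ErrorUncorrelated C i E N := by
    constructor
    · ext a r
      exact congrFun₂ (estimates_uncorrelated_past G U hC hCdiag r.1.2 i).1 a r.2
    · ext a r
      exact congrFun₂ (estimates_uncorrelated_past G U hC hCdiag r.1.2 i).2 a r.2
  set Φ : (Fin m → ℝ) × (Fin t × G.neighborSet i × Fin m → ℝ) → History G m i t := fun p =>
    (p.1, fun u j k => (N *ᵥ (repState V m *ᵥ p.1)) (u, j, k) + p.2 (u, j, k)) with hΦdef
  have hΦ : Measurable Φ := by
    have : Measurable fun p : (Fin m → ℝ) × (Fin t × G.neighborSet i × Fin m → ℝ) =>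
        N *ᵥ (repState V m *ᵥ p.1) :=
      (measurable_mulVec N).comp ((measurable_mulVec _).comp measurable_fst)
    refine measurable_fst.prodMk (measurable_pi_lambda _ fun u => measurable_pi_lambda _ fun j =>
      measurable_pi_lambda _ fun k => ?_)
    exact ((measurable_pi_apply (u, j, k)).comp this).add
      ((measurable_pi_apply (u, j, k)).comp measurable_snd)
  set pt : (Fin m → ℝ) × (Fin m × V → ℝ) → State V m := fun ω =>
    (ω.1 - ownSignal m i *ᵥ ω.2, repState V m *ᵥ ω.1 + relSignal m i *ᵥ ω.2) with hpt
  have hptm : Measurable pt := measurable_ownCoordinates i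
  have hprior : prior C = (volume.prod (stackedNoise C)).map pt := prior_eq_map_own C i
  have hhist : ∀ ω, linearHistory G C U i t (pt ω).2
      = Φ (ω.1, (N * relSignal m i) *ᵥ ω.2) := by
    intro ω
    refine Prod.ext ?_ (funext fun u => funext fun j => funext fun k => ?_)
    · exact (ownSignal_mulVec i _).symm.trans (ownSignal_mulVec_add i ω.1 ω.2)
    · have h : (N *ᵥ (pt ω).2) (u, j, k)
          = (N *ᵥ (repState V m *ᵥ ω.1)) (u, j, k) + ((N * relSignal m i) *ᵥ ω.2) (u, j, k) := by
        rw [hpt, mulVec_add, Pi.add_apply, mulVec_mulVec _ N (relSignal m i)]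
      exact (stageObs_mulVec G C U u i _ (j, k)).symm.trans h
  have hdecomp : ∀ ω, pt ω = ℓ (linearHistory G C U i t (pt ω).2) + errorMap E ω.2 := by
    intro ω
    have hQ : E.Q * relSignal m i = E.Q - ownSignal m i := by
      rw [relSignal, Matrix.mul_sub, ← Matrix.mul_assoc, hlmmse.Q_mul_repState, Matrix.mul_one,
        Matrix.one_mul]
    have hL : (1 - E.L) *ᵥ (pt ω).2 = (1 - E.L) *ᵥ ω.2 := by
      rw [hpt, mulVec_add, mulVec_mulVec, mulVec_mulVec, sub_mul_relSignal hlmmse.L_mul_repState,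
        Matrix.sub_mul, hlmmse.L_mul_repState, Matrix.one_mul, sub_self, zero_mulVec, zero_add]
    rw [hℓx, errorMap_apply]
    refine Prod.ext ?_ ?_
    · simp only [hpt, Prod.fst_add, mulVec_add, mulVec_mulVec, hQ, hlmmse.Q_mul_repState,
        one_mulVec, Matrix.sub_mulVec, Matrix.neg_mulVec]
      abel
    · rw [Prod.snd_add, ← hL, Matrix.sub_mulVec, one_mulVec, add_sub_cancel]
  have hlinm : Measurable fun ω : State V m => linearHistory G C U i t ω.2 := by
    refine Measurable.prodMk (by fun_prop) (measurable_pi_lambda _ fun u =>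
      measurable_pi_lambda _ fun j => ?_)
    exact (measurable_mulVec _).comp ((measurable_mulVec _).comp measurable_snd)
  have key := map_prod_eq_compProd_translateKernel (μ := (volume : Measure (Fin m → ℝ)))
    (ν := stackedNoise C) (measurable_mulVec _) (errorMap E).measurable
    (indepFun_errorMap hC hCdiag hNunc) hΦ hℓ
  have hmarg : (volume.prod (stackedNoise C)).map
      (fun p => Φ (p.1, (N * relSignal m i) *ᵥ p.2))
      = (prior C).map fun ω => history G σ i t ω.2 := by
    rw [Measure.map_congr hlin, hprior, Measure.map_map hlinm hptm]
    simp only [Function.comp_def, hhist]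
  have hjoint : (volume.prod (stackedNoise C)).map
      (fun p => (Φ (p.1, (N * relSignal m i) *ᵥ p.2),
        ℓ (Φ (p.1, (N * relSignal m i) *ᵥ p.2)) + errorMap E p.2))
      = (prior C).map fun ω => (history G σ i t ω.2, ω) := by
    have : (fun ω : State V m => (history G σ i t ω.2, ω))
        =ᵐ[prior C] fun ω => (linearHistory G C U i t ω.2, ω) := by
      filter_upwards [hlin] with ω hω
      rw [hω]
    rw [Measure.map_congr this, hprior, Measure.map_map (hlinm.prodMk measurable_id') hptm]
    congr 1
    funext ω
    simp only [Function.comp, ← hhist, ← hdecomp]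
  rw [hmarg, hjoint, hP.disintegration i t] at key
  have hae := ae_of_ae_map hm.aemeasurable (ae_eq_of_compProd_eq_of_sigmaFinite key)
  filter_upwards [hae, hlin] with ω h1 h2
  rw [h1, translateKernel_apply _ _ hℓ, h2, hℓx]
  rfl

theorem ae_history_eq_linearHistory {i : V} {t : ℕ}
    (h : ∀ u < t, ∀ j, ∀ᵐ ω ∂prior C,
      action G σ ω.2 u j = U j u *ᵥ ((estimates G C U u j).L *ᵥ ω.2)) :
    ∀ᵐ ω ∂prior C, history G σ i t ω.2 = linearHistory G C U i t ω.2 := by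
  have h' : ∀ᵐ ω ∂prior C, ∀ (u : Fin t) (j : V),
      action G σ ω.2 u j = U j u *ᵥ ((estimates G C U u j).L *ᵥ ω.2) :=
    ae_all_iff.2 fun u => ae_all_iff.2 fun j => h u u.2 j
  filter_upwards [h'] with ω hω
  exact Prod.ext rfl (funext fun u => funext fun j => hω u j)

/-- All beliefs are Gaussian, with the recorded means and covariances. -/
theorem ae_isGaussianBelief (hC : ∀ i, (C i).PosSemidef) (hCdiag : ∀ i, (C i).IsDiag)
    (hσ : ∀ i t, Measurable (σ i t)) (hP : IsBeliefSystem G C σ P)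
    (hU : IsLinearProfile G C σ P U) (t : ℕ) (i : V) :
    ∀ᵐ ω ∂prior C,
      IsGaussianBelief (P i t (history G σ i t ω.2)) (estimates G C U t i) ω.2 := by
  induction t using Nat.strong_induction_on generalizing i with
  | _ t ih =>
    have hact : ∀ u < t, ∀ j, ∀ᵐ ω ∂prior C,
        action G σ ω.2 u j = U j u *ᵥ ((estimates G C U u j).L *ᵥ ω.2) := by
      intro u hu j
      filter_upwards [hU j u, ih u hu j] with ω h1 h2
      rw [action_eq, h1, h2.mean_signals]
    filter_upwards [ae_belief_eq hC hCdiag hσ hP (ae_history_eq_linearHistory hact)] with ω hω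
    rw [hω]
    exact isGaussianBelief_gaussianBelief hC hCdiag (estimates_isLMMSE G U hC hCdiag t i) ω.2

theorem ae_action_eq (hC : ∀ i, (C i).PosSemidef) (hCdiag : ∀ i, (C i).IsDiag)
    (hσ : ∀ i t, Measurable (σ i t)) (hP : IsBeliefSystem G C σ P)
    (hU : IsLinearProfile G C σ P U) (t : ℕ) (j : V) :
    ∀ᵐ ω ∂prior C, action G σ ω.2 t j = U j t *ᵥ ((estimates G C U t j).L *ᵥ ω.2) := by
  filter_upwards [hU j t, ae_isGaussianBelief hC hCdiag hσ hP hU t j] with ω h1 h2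
  rw [action_eq, h1, h2.mean_signals]

end Identification

/-! ### Identities on the support of the signals -/

section Support

variable {V : Type*} [Fintype V] [DecidableEq V] {m : ℕ} {C : V → Matrix (Fin m) (Fin m) ℝ}

/-- A linear map that annihilates the private signals almost surely annihilates the support of
their law. -/
theorem mul_eq_zero_of_ae_mulVec_eq_zero (hC : ∀ i, (C i).PosSemidef)
    (hCdiag : ∀ i, (C i).IsDiag) {R : Type*} [Fintype R] {W : Matrix R (Fin m × V) ℝ}
    (h : ∀ᵐ ω ∂prior C, W *ᵥ ω.2 = 0) : W * repState V m = 0 ∧ W * noiseCov C = 0 := by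
  have hm : Measurable fun ω : (Fin m → ℝ) × (Fin m × V → ℝ) =>
      (ω.1, repState V m *ᵥ ω.1 + ω.2) :=
    measurable_fst.prodMk (((measurable_mulVec _).comp measurable_fst).add measurable_snd)
  rw [prior_eq_map] at h
  have h1 := Measure.ae_ae_of_ae_prod (Measure.measurePreserving_swap.quasiMeasurePreserving.ae
    (ae_of_ae_map hm.aemeasurable h))
  -- For fixed noise the equation is continuous in the state, hence holds for all states.
  have h2 : ∀ᵐ e ∂stackedNoise C, ∀ y, W *ᵥ (repState V m *ᵥ y + e) = 0 := by
    filter_upwards [h1] with e he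
    have hc : Continuous fun y => W *ᵥ (repState V m *ᵥ y + e) := by fun_prop
    exact fun y => congrFun ((hc.ae_eq_iff_eq volume continuous_const).1 he) y
  constructor
  · obtain ⟨e, he⟩ := h2.exists
    refine Matrix.ext_of_mulVec_single fun k => ?_
    have ha := he (Pi.single k 1)
    have hb := he 0
    rw [mulVec_zero, zero_add] at hb
    rw [mulVec_add, hb, add_zero, mulVec_mulVec] at ha
    rw [ha, zero_mulVec]
  · refine mul_noiseCov_eq_zero hC W ?_
    ext k l
    rw [← covariance_mulVec (stackedNoise_cov hC hCdiag)]
    have h3 : (fun e => (W *ᵥ e) k) =ᵐ[stackedNoise C] fun _ => 0 := by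
      filter_upwards [h2] with e he
      have := he 0
      rw [mulVec_zero, zero_add] at this
      rw [this]; rfl
    have h4 := integral_congr_ae h3
    rw [covariance, h4]
    refine (integral_congr_ae (g := fun _ => 0) ?_).trans (by simp)
    filter_upwards [h3] with e he
    simp [he]

/-- An identity between linear functions of the estimates that holds almost surely holds
everywhere. -/
theorem Estimate.AttainedOnSupport.eq_zero {E : Estimate V m} (hE : E.AttainedOnSupport C)
    (hC : ∀ i, (C i).PosSemidef) (hCdiag : ∀ i, (C i).IsDiag)
    {A : Matrix (Fin m) (Fin m × V) ℝ} {B : Matrix (Fin m) (Fin m) ℝ}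
    (h : ∀ᵐ ω ∂prior C, (A * E.L + B * E.Q) *ᵥ ω.2 = 0) : A * E.L + B * E.Q = 0 := by
  obtain ⟨h1, h2⟩ := mul_eq_zero_of_ae_mulVec_eq_zero hC hCdiag h
  refine Matrix.ext_of_mulVec_single fun p => ?_
  obtain ⟨y, z, hL, hQ⟩ := hE (Pi.single p 1)
  rw [Matrix.add_mulVec, ← mulVec_mulVec, ← mulVec_mulVec, ← hL, ← hQ, mulVec_mulVec _ A,
    mulVec_mulVec _ B, ← Matrix.add_mulVec, mulVec_add, mulVec_mulVec, mulVec_mulVec, h1, h2,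
    zero_mulVec, zero_mulVec, zero_mulVec, add_zero]

end Support

/-! ### Expected payoffs -/

section Payoff

variable {V : Type*} [Fintype V] {m : ℕ}

theorem IsGaussianBelief.memLp_state {ν : Measure (State V m)} {E : Estimate V m}
    {x : Fin m × V → ℝ} (h : IsGaussianBelief ν E x) (k : Fin m) :
    MemLp (fun ω => ω.1 k) 2 ν :=
  have := h.gaussian
  IsGaussian.memLp_dual ν ((ContinuousLinearMap.proj (R := ℝ) (φ := fun _ : Fin m => ℝ) k).comp
    (ContinuousLinearMap.fst ℝ _ _)) 2 (by norm_num)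

theorem IsGaussianBelief.memLp_signals {ν : Measure (State V m)} {E : Estimate V m}
    {x : Fin m × V → ℝ} (h : IsGaussianBelief ν E x) (p : Fin m × V) :
    MemLp (fun ω => ω.2 p) 2 ν :=
  have := h.gaussian
  IsGaussian.memLp_dual ν ((ContinuousLinearMap.proj (R := ℝ) (φ := fun _ : Fin m × V => ℝ) p).comp
    (ContinuousLinearMap.snd ℝ _ _)) 2 (by norm_num)

variable [DecidableEq V]

/-- The concave quadratic `a ↦ -a ⬝ᵥ a / 2 + a ⬝ᵥ b + c` has the unique maximizer `b`. -/
theorem isMaxOn_quadratic_iff {ι : Type*} [Fintype ι] (b s : ι → ℝ) (c : ℝ) :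
    IsMaxOn (fun a : ι → ℝ => -(1 / 2) * (a ⬝ᵥ a) + a ⬝ᵥ b + c) Set.univ s ↔ s = b := by
  have key : ∀ a : ι → ℝ, -(1 / 2) * (a ⬝ᵥ a) + a ⬝ᵥ b + c
      = -(1 / 2) * ((a - b) ⬝ᵥ (a - b)) + (1 / 2) * (b ⬝ᵥ b) + c := by
    intro a
    rw [sub_dotProduct, dotProduct_sub, dotProduct_sub, dotProduct_comm b a]
    ring
  have hnn : ∀ v : ι → ℝ, 0 ≤ v ⬝ᵥ v := fun v => Finset.sum_nonneg fun i _ => mul_self_nonneg _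
  simp only [isMaxOn_iff, Set.mem_univ, true_implies, key]
  constructor
  · intro h
    have h1 := h b
    rw [sub_self, zero_dotProduct] at h1
    have h2 : (s - b) ⬝ᵥ (s - b) = 0 := le_antisymm (by linarith) (hnn _)
    exact sub_eq_zero.1 (dotProduct_self_eq_zero.1 h2)
  · rintro rfl a
    have := hnn (a - s)
    rw [sub_self, zero_dotProduct]
    linarith

theorem payoff_update (B : V → V → Matrix (Fin m) (Fin m) ℝ) (D : Matrix (Fin m) (Fin m) ℝ)
    (i : V) (b : V → Fin m → ℝ) (a θ : Fin m → ℝ) :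
    payoff B D i (Function.update b i a) θ
      = -(1 / 2) * (a ⬝ᵥ a) + ∑ j ∈ Finset.univ.erase i, a ⬝ᵥ (B i j *ᵥ b j) + a ⬝ᵥ (D *ᵥ θ)
        - (1 / 2) * ∑ j ∈ Finset.univ.erase i, b j ⬝ᵥ b j := by
  have h : ∀ j ∈ Finset.univ.erase i, Function.update b i a j = b j := fun j hj =>
    Function.update_of_ne (Finset.ne_of_mem_erase hj) _ _
  rw [payoff, ← Finset.add_sum_erase _ _ (Finset.mem_univ i), Function.update_self,
    Finset.sum_congr rfl fun j hj => congrArg₂ (· ⬝ᵥ ·) (h j hj) (h j hj),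
    Finset.sum_congr rfl fun j hj => congrArg (fun v => a ⬝ᵥ (B i j *ᵥ v)) (h j hj)]
  ring

/-- Expectations of affine functions only involve the mean, so that the expected payoff is a
concave quadratic in the own action `a`. -/
theorem IsGaussianBelief.expected_payoff {ν : Measure (State V m)} {E : Estimate V m}
    {x : Fin m × V → ℝ} (h : IsGaussianBelief ν E x) (B : V → V → Matrix (Fin m) (Fin m) ℝ)
    (D : Matrix (Fin m) (Fin m) ℝ) (i : V) (A : V → Matrix (Fin m) (Fin m × V) ℝ) :
    ∃ c, ∀ a : Fin m → ℝ,
      Integrable (fun ω => payoff B D i (Function.update (fun j => A j *ᵥ ω.2) i a) ω.1) ν ∧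
      ∫ ω, payoff B D i (Function.update (fun j => A j *ᵥ ω.2) i a) ω.1 ∂ν
        = -(1 / 2) * (a ⬝ᵥ a)
          + a ⬝ᵥ ((∑ j ∈ Finset.univ.erase i, B i j *ᵥ (A j *ᵥ (E.L *ᵥ x))) + D *ᵥ (E.Q *ᵥ x))
          + c := by
  have := h.gaussian
  have hx : ∀ {κ : Type} (N : Matrix κ (Fin m × V) ℝ) (k : κ),
      MemLp (fun ω => (N *ᵥ ω.2) k) 2 ν := by
    intro κ N k
    simp only [mulVec, dotProduct]
    exact memLp_finsetSum _ fun p _ => (h.memLp_signals p).const_mul _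
  have hdx : ∀ v : Fin m × V → ℝ, Integrable (fun ω => v ⬝ᵥ ω.2) ν ∧
      ∫ ω, v ⬝ᵥ ω.2 ∂ν = v ⬝ᵥ (E.L *ᵥ x) := by
    intro v
    have hi : ∀ p, Integrable (fun ω : State V m => v p * ω.2 p) ν := fun p =>
      ((h.memLp_signals p).integrable (by norm_num)).const_mul _
    refine ⟨integrable_finsetSum _ fun p _ => hi p, ?_⟩
    rw [← h.mean_signals]
    simp only [dotProduct]
    rw [integral_finsetSum _ fun p _ => hi p]
    simp only [integral_const_mul, expSignals]
  have hdθ : ∀ v : Fin m → ℝ, Integrable (fun ω => v ⬝ᵥ ω.1) ν ∧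
      ∫ ω, v ⬝ᵥ ω.1 ∂ν = v ⬝ᵥ (E.Q *ᵥ x) := by
    intro v
    have hi : ∀ k, Integrable (fun ω : State V m => v k * ω.1 k) ν := fun p =>
      ((h.memLp_state p).integrable (by norm_num)).const_mul _
    refine ⟨integrable_finsetSum _ fun p _ => hi p, ?_⟩
    rw [← h.mean_state]
    simp only [dotProduct]
    rw [integral_finsetSum _ fun p _ => hi p]
    simp only [integral_const_mul, expState]
  have hsq : Integrable (fun ω : State V m =>
      (1 / 2) * ∑ j ∈ Finset.univ.erase i, (A j *ᵥ ω.2) ⬝ᵥ (A j *ᵥ ω.2)) ν :=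
    (integrable_finsetSum _ fun j _ => integrable_finsetSum _ fun k _ =>
      (hx (A j) k).integrable_mul (hx (A j) k)).const_mul _
  refine ⟨-∫ ω, (1 / 2) * ∑ j ∈ Finset.univ.erase i, (A j *ᵥ ω.2) ⬝ᵥ (A j *ᵥ ω.2) ∂ν, fun a => ?_⟩
  have hp : ∀ ω : State V m, payoff B D i (Function.update (fun j => A j *ᵥ ω.2) i a) ω.1
      = -(1 / 2) * (a ⬝ᵥ a)
        + (∑ j ∈ Finset.univ.erase i, a ᵥ* (B i j * A j)) ⬝ᵥ ω.2 + (a ᵥ* D) ⬝ᵥ ω.1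
        - (1 / 2) * ∑ j ∈ Finset.univ.erase i, (A j *ᵥ ω.2) ⬝ᵥ (A j *ᵥ ω.2) := by
    intro ω
    rw [payoff_update, sum_dotProduct]
    simp only [← dotProduct_mulVec, mulVec_mulVec]
  have hi1 : Integrable (fun ω : State V m => -(1 / 2) * (a ⬝ᵥ a)
      + (∑ j ∈ Finset.univ.erase i, a ᵥ* (B i j * A j)) ⬝ᵥ ω.2) ν :=
    (integrable_const _).add (hdx _).1
  have hi2 : Integrable (fun ω : State V m => -(1 / 2) * (a ⬝ᵥ a)
      + (∑ j ∈ Finset.univ.erase i, a ᵥ* (B i j * A j)) ⬝ᵥ ω.2 + (a ᵥ* D) ⬝ᵥ ω.1) ν :=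
    hi1.add (hdθ _).1
  simp only [hp]
  refine ⟨hi2.sub hsq, ?_⟩
  rw [integral_sub hi2 hsq, integral_add hi1 (hdθ _).1,
    integral_add (integrable_const _) (hdx _).1, (hdx _).2, (hdθ _).2, integral_const,
    probReal_univ, one_smul, sum_dotProduct, dotProduct_add, dotProduct_sum]
  simp only [← dotProduct_mulVec, mulVec_mulVec, Matrix.mul_assoc]
  ring

end Payoff

/-! ### Stage equilibria -/

section Equilibrium

variable {V : Type*} [Fintype V] [DecidableEq V] {m : ℕ} {G : SimpleGraph V}
  {C : V → Matrix (Fin m) (Fin m) ℝ} {σ : Strategy G m}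
  {P : ∀ (i : V) (t : ℕ), Kernel (History G m i t) (State V m)}

/-- Agents are almost surely certain of what holds almost surely. -/
theorem IsBeliefSystem.ae_ae (hσ : ∀ i t, Measurable (σ i t)) (hP : IsBeliefSystem G C σ P)
    {p : State V m → Prop} (hp : ∀ᵐ ω ∂prior C, p ω) (i : V) (t : ℕ) :
    ∀ᵐ ω ∂prior C, ∀ᵐ ω' ∂P i t (history G σ i t ω.2), p ω' := by
  have := hP.markov i t
  have := sigmaFinite_map_history C hσ i t
  have hm : Measurable fun ω : State V m => history G σ i t ω.2 :=
    (measurable_history hσ i t).comp measurable_snd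
  have h1 : ((prior C).map fun ω => (history G σ i t ω.2, ω)).map Prod.snd = prior C := by
    rw [Measure.map_map measurable_snd (hm.prodMk measurable_id')]
    exact Measure.map_id
  have h2 : ∀ᵐ q ∂(prior C).map fun ω => (history G σ i t ω.2, ω), p q.2 := by
    rw [← h1] at hp
    exact ae_of_ae_map measurable_snd.aemeasurable hp
  rw [hP.disintegration i t] at h2
  exact ae_of_ae_map hm.aemeasurable (Measure.ae_ae_of_ae_compProd h2)

variable [DecidableRel G.Adj] {U : V → ℕ → Matrix (Fin m) (Fin m × V) ℝ}

/-- The first order condition: the best reply to linear strategies, in terms of the private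
signals. -/
theorem isStageEquilibrium_iff_ae (B : V → V → Matrix (Fin m) (Fin m) ℝ)
    (D : Matrix (Fin m) (Fin m) ℝ) (hC : ∀ i, (C i).PosSemidef) (hCdiag : ∀ i, (C i).IsDiag)
    (hσ : ∀ i t, Measurable (σ i t)) (hP : IsBeliefSystem G C σ P)
    (hU : IsLinearProfile G C σ P U) (t : ℕ) :
    IsStageEquilibrium G B D C σ P t ↔ ∀ i, ∀ᵐ ω ∂prior C,
      U i t *ᵥ ((estimates G C U t i).L *ᵥ ω.2)
        = (∑ j ∈ Finset.univ.erase i,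
            B i j *ᵥ ((U j t * (estimates G C U t j).L) *ᵥ ((estimates G C U t i).L *ᵥ ω.2)))
          + D *ᵥ ((estimates G C U t i).Q *ᵥ ω.2) := by
  have hact : ∀ᵐ ω ∂prior C, (fun j => action G σ ω.2 t j)
      = fun j => (U j t * (estimates G C U t j).L) *ᵥ ω.2 := by
    filter_upwards [ae_all_iff.2 (ae_action_eq hC hCdiag hσ hP hU t)] with ω hω
    funext j
    rw [hω j, mulVec_mulVec]
  refine forall_congr' fun i => Filter.eventually_congr ?_
  filter_upwards [ae_isGaussianBelief hC hCdiag hσ hP hU t i, hP.ae_ae hσ hact i t, hU i t]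
    with ω hG hA hu
  obtain ⟨c, hc⟩ := hG.expected_payoff B D i fun j => U j t * (estimates G C U t j).L
  have hae : ∀ a : Fin m → ℝ,
      (fun ω' : State V m => payoff B D i (Function.update (action G σ ω'.2 t) i a) ω'.1)
        =ᵐ[P i t (history G σ i t ω.2)] fun ω' => payoff B D i
          (Function.update (fun j => (U j t * (estimates G C U t j).L) *ᵥ ω'.2) i a) ω'.1 := by
    intro a
    filter_upwards [hA] with ω' hω'
    rw [← hω']
  have hint : ∀ a : Fin m → ℝ, Integrable
      (fun ω' => payoff B D i (Function.update (action G σ ω'.2 t) i a) ω'.1)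
      (P i t (history G σ i t ω.2)) := fun a => (hc a).1.congr (hae a).symm
  rw [and_iff_right hint]
  simp only [fun a => (integral_congr_ae (hae a)).trans (hc a).2]
  rw [isMaxOn_quadratic_iff, hu, hG.mean_signals]

end Equilibrium

end QuadraticNetworkGame

end

theorem theorem2 {V : Type*} [Fintype V] [DecidableEq V] {m : ℕ}
    (G : SimpleGraph V) [DecidableRel G.Adj]
    (B : V → V → Matrix (Fin m) (Fin m) ℝ) (D : Matrix (Fin m) (Fin m) ℝ)
    (C : V → Matrix (Fin m) (Fin m) ℝ)
    (hC : ∀ i, (C i).PosSemidef) (hCdiag : ∀ i, (C i).IsDiag)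
    (σ : QuadraticNetworkGame.Strategy G m) (hσ : ∀ i t, Measurable (σ i t))
    (P : ∀ (i : V) (t : ℕ), Kernel (QuadraticNetworkGame.History G m i t)
      (QuadraticNetworkGame.State V m))
    (hP : QuadraticNetworkGame.IsBeliefSystem G C σ P)
    (U : V → ℕ → Matrix (Fin m) (Fin m × V) ℝ)
    (hU : QuadraticNetworkGame.IsLinearProfile G C σ P U) :
    (∀ t, QuadraticNetworkGame.IsStageEquilibrium G B D C σ P t ↔
      ∀ i,
        (QuadraticNetworkGame.estimates G C U t i).Lᵀ * (U i t)ᵀ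
          = ∑ j ∈ Finset.univ.erase i,
              (QuadraticNetworkGame.estimates G C U t i).Lᵀ
                * (QuadraticNetworkGame.estimates G C U t j).Lᵀ * (U j t)ᵀ * (B i j)ᵀ
            + (QuadraticNetworkGame.estimates G C U t i).Qᵀ * Dᵀ) ∧
    (∀ i t, ∀ᵐ ω ∂QuadraticNetworkGame.prior C,
      QuadraticNetworkGame.IsGaussianBelief
        (P i t (QuadraticNetworkGame.history G σ i t ω.2))
        (QuadraticNetworkGame.estimates G C U t i) ω.2) := by
  refine ⟨fun t => ?_, fun i t =>
    QuadraticNetworkGame.ae_isGaussianBelief hC hCdiag hσ hP hU t i⟩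
  rw [QuadraticNetworkGame.isStageEquilibrium_iff_ae B D hC hCdiag hσ hP hU t]
  refine forall_congr' fun i => ?_
  set L := fun j => (QuadraticNetworkGame.estimates G C U t j).L
  set Q := (QuadraticNetworkGame.estimates G C U t i).Q
  set A := U i t - ∑ j ∈ Finset.univ.erase i, B i j * (U j t * L j) with hA
  -- The equilibrium equations say that this combination of the estimates vanishes identically.
  have hpt : ∀ x, (A * L i + -D * Q) *ᵥ x = U i t *ᵥ (L i *ᵥ x)
      - ((∑ j ∈ Finset.univ.erase i, B i j *ᵥ ((U j t * L j) *ᵥ (L i *ᵥ x))) + D *ᵥ (Q *ᵥ x)) := by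
    intro x
    rw [Matrix.add_mulVec, ← mulVec_mulVec, ← mulVec_mulVec, hA, Matrix.sub_mulVec,
      Matrix.sum_mulVec, Matrix.neg_mulVec]
    simp only [mulVec_mulVec, Matrix.mul_assoc]
    abel
  have htr : (A * L i + -D * Q)ᵀ = (L i)ᵀ * (U i t)ᵀ
      - (∑ j ∈ Finset.univ.erase i, (L i)ᵀ * (L j)ᵀ * (U j t)ᵀ * (B i j)ᵀ + Qᵀ * Dᵀ) := by
    rw [hA, Matrix.transpose_add, Matrix.transpose_mul, Matrix.transpose_mul, Matrix.transpose_sub,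
      Matrix.transpose_sum, Matrix.mul_sub, Matrix.mul_sum, Matrix.transpose_neg, Matrix.mul_neg]
    simp only [Matrix.transpose_mul, Matrix.mul_assoc]
    abel
  rw [← sub_eq_zero (a := (L i)ᵀ * (U i t)ᵀ), ← htr, Matrix.transpose_eq_zero]
  constructor
  · intro h
    refine (QuadraticNetworkGame.estimates_attainedOnSupport G U hC hCdiag t i).eq_zero hC hCdiag ?_
    filter_upwards [h] with ω hω
    exact (hpt ω.2).trans (sub_eq_zero.2 hω)
  · intro h
    refine Filter.Eventually.of_forall fun ω => sub_eq_zero.1 ?_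
    rw [← hpt, h, zero_mulVec]
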